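/- Let $\xi$ be a transcendental real number. For $n\ge 1$ let $\widehat\lambda_n(\xi)$ be the supremum of the real $\lambda$ such that for all sufficiently large $X$ the system $$1\le x\le X,\qquad \max_{1\le j\le n}|\xi^j x-y_j|\le X^{-\lambda}$$ has a solution in integers $x,y_1,\dots,y_n$, and let $\widehat w_n(\xi)$ be the supremum (in $[-\infty,\infty]$) of the real $w$ such that for all sufficiently large $X$ the system $$1\le \max_{1\le j\le n}|a_j|\le X,\qquad |a_0+a_1\xi+\cdots+a_n\xi^n|\le X^{-w}$$ has a solution in integers $a_0,\dots,a_n$. Put $$\overline{\widehat w}(\xi)=\limsup_{n\to\infty}\frac{\widehat w_n(\xi)}{n},\quad \underline{\widehat w}(\xi)=\liminf_{n\to\infty}\frac{\widehat w_n(\xi)}{n},\quad \overline{\widehat\lambda}(\xi)=\limsup_{n\to\infty} n\widehat\lambda_n(\xi),\quad \underline{\widehat\lambda}(\xi)=\liminf_{n\to\infty} n\widehat\lambda_n(\xi).$$ For $t\in[1,2]$ let $$R(t)=\frac{t-\sqrt{2t-t^2}}{2t},\qquad S(t)=\frac{1-2R(t)}{1-(t+1)R(t)+tR(t)^2}\quad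 (1\le t<2),\qquad S(2)=2,$$ where $S(2)$ is the limit of the quotient as $t\to 2^-$ (at $t=2$ the quotient itself is $0/0$). Then $\overline{\widehat\lambda}(\xi)$ and $\underline{\widehat\lambda}(\xi)$ lie in $[1,2]$, and $$\overline{\widehat w}(\xi)\ \ge\ S\bigl(\overline{\widehat\lambda}(\xi)\bigr),\qquad \underline{\widehat w}(\xi)\ \ge\ S\bigl(\underline{\widehat\lambda}(\xi)\bigr).$$ Moreover $S$ is strictly increasing on $[1,2]$ and maps $[1,2]$ bijectively onto itself. -/

import Mathlib

open Filter

noncomputable section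

namespace DiophExp

/-- The pair of conditions `1 ≤ x ≤ X` and `max_{1 ≤ j ≤ n} |ξ ^ j x - y_j| ≤ X ^ (-lam)` has a
solution in integers `x, y_1, …, y_n` (here `y j` stands for `y_{j+1}`). -/
def SimulSolvable (n : ℕ) (ξ lam X : ℝ) : Prop :=
  ∃ (x : ℤ) (y : Fin n → ℤ), 1 ≤ x ∧ (x : ℝ) ≤ X ∧
    ∀ j : Fin n, |ξ ^ ((j : ℕ) + 1) * (x : ℝ) - (y j : ℝ)| ≤ X ^ (-lam)

/-- The pair of conditions `1 ≤ max_{1 ≤ j ≤ n} |a_j| ≤ X` and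
`|a_0 + a_1 ξ + ⋯ + a_n ξ ^ n| ≤ X ^ (-w)` has a solution in integers `a_0, …, a_n`. -/
def LinFormSolvable (n : ℕ) (ξ w X : ℝ) : Prop :=
  ∃ a : Fin (n + 1) → ℤ,
    (∃ j : Fin n, 1 ≤ |a j.succ|) ∧ (∀ j : Fin n, |(a j.succ : ℝ)| ≤ X) ∧
      |∑ i : Fin (n + 1), (a i : ℝ) * ξ ^ (i : ℕ)| ≤ X ^ (-w)

/-- The uniform exponent of simultaneous approximation to `ξ, ξ ^ 2, …, ξ ^ n`: the supremum, in
the extended reals, of the real `lam` such that the system is solvable for all large real `X`. -/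
def hatLambda (n : ℕ) (ξ : ℝ) : EReal :=
  sSup (Real.toEReal '' {lam : ℝ | ∀ᶠ X : ℝ in atTop, SimulSolvable n ξ lam X})

/-- The uniform linear form exponent: the supremum, in the extended reals, of the real `w` such
that the system is solvable for all large real `X`. -/
def hatW (n : ℕ) (ξ : ℝ) : EReal :=
  sSup (Real.toEReal '' {w : ℝ | ∀ᶠ X : ℝ in atTop, LinFormSolvable n ξ w X})

def upperHatLambda (ξ : ℝ) : EReal :=
  limsup (fun n : ℕ => (n : EReal) * hatLambda n ξ) atTop

def lowerHatLambda (ξ : ℝ) : EReal :=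
  liminf (fun n : ℕ => (n : EReal) * hatLambda n ξ) atTop

def upperHatW (ξ : ℝ) : EReal :=
  limsup (fun n : ℕ => hatW n ξ / (n : EReal)) atTop

def lowerHatW (ξ : ℝ) : EReal :=
  liminf (fun n : ℕ => hatW n ξ / (n : EReal)) atTop

def R (t : ℝ) : ℝ := (t - √(2 * t - t ^ 2)) / (2 * t)

/-- The function `S` on `[1, 2]`. At `t = 2` the quotient has the form `0 / 0` and `S` takes the
value `2`, which is the limit of the quotient for `t → 2` from the left. -/
def S (t : ℝ) : ℝ :=
  if t = 2 then 2 else (1 - 2 * R t) / (1 - (t + 1) * R t + t * R t ^ 2)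

end DiophExp

end

/-! The theorem is a transference from simultaneous approximation in dimension `n = m + r` to linear
forms in dimension `m`. A good denominator `q` has nearest integers `y_i` to `ξ ^ i q`, with `y_0 =
q`; the windows `(y_j, …, y_{j+m})`, `0 ≤ j ≤ r`, form a Hankel matrix. An integer vector with small
linear form and moderate coefficients is orthogonal to every window, since each product is an
integer of absolute value below 1. If the `r + 1` windows are independent, Minkowski's box may be
stretched in `r + 1` directions at no cost, which improves on Dirichlet
(`exists_int_coeffs_of_fullRank`).

Independence is the heart of the matter (`eventually_annihilators_eq_bot`). When `lam * m > 1`, a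
Dirichlet polynomial `P` of degree at most `m` kills all windows of good denominators of its range.
If `Q` of degree at most `r` is orthogonal to the windows of length `r + 1` of the newer
denominator, then `gcd(P, Q)` controls the older one as well, so the spaces of such `Q` decrease.
They stabilise, and a `Q` in the limit vanishes at `ξ`, hence is zero. The same fact yields `lam * m
≤ 1` for `m ≤ r`, whence the upper bound 2.

With `m ≈ α n`, `lam = t / n` and `w = s m`, the condition becomes `s < (2α - 1) / (α (1 - t (1 -
α)))`. The right side is stationary at `α = 1 - R t`, where it equals `S t`. -/

namespace DiophExp

/-! ### Geometry of numbers: Minkowski, the stretched box, Dirichlet. -/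

open Matrix MeasureTheory in
/-- Minkowski's theorem on linear forms. -/
theorem exists_int_forall_abs_mulVec_lt {ι : Type*} [Fintype ι] [DecidableEq ι]
    (A : Matrix ι ι ℝ) (c : ι → ℝ) (hc : ∀ i, 0 < c i) (hA : A.det ≠ 0)
    (h : |A.det| < ∏ i, c i) :
    ∃ p : ι → ℤ, p ≠ 0 ∧ ∀ i, |(A *ᵥ fun j ↦ (p j : ℝ)) i| < c i := by
  classical
  let f : (ι → ℝ) →ₗ[ℝ] (ι → ℝ) := Matrix.toLin' A
  have hfdet : LinearMap.det f = A.det := LinearMap.det_toLin' A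
  let box : Set (ι → ℝ) := Set.pi Set.univ fun i ↦ Set.Ioo (-c i) (c i)
  have hmem : ∀ x, x ∈ f ⁻¹' box ↔ ∀ i, |(A *ᵥ x) i| < c i := by
    intro x
    simp [box, f, abs_lt, Set.mem_pi, Matrix.toLin'_apply]
  have hconv : Convex ℝ (f ⁻¹' box) :=
    (convex_pi fun i _ ↦ convex_Ioo _ _).linear_preimage f
  have hvol : volume (f ⁻¹' box) = ENNReal.ofReal (|A.det|⁻¹ * ∏ i, (2 * c i)) := by
    rw [Measure.addHaar_preimage_linearMap _ (by rwa [hfdet]), hfdet, volume_pi,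
      Measure.pi_pi, abs_inv, ENNReal.ofReal_mul (by positivity),
      ENNReal.ofReal_prod_of_nonneg fun i _ ↦ by have := hc i; positivity]
    congr 1
    refine Finset.prod_congr rfl fun i _ ↦ ?_
    rw [Real.volume_Ioo]
    congr 1
    ring
  have : Countable (Submodule.span ℤ (Set.range (Pi.basisFun ℝ ι))).toAddSubgroup :=
    inferInstanceAs (Countable (Submodule.span ℤ (Set.range (Pi.basisFun ℝ ι))))
  obtain ⟨x, hx0, hx⟩ := exists_ne_zero_mem_lattice_of_measure_mul_two_pow_lt_measure
    (μ := volume) (s := f ⁻¹' box) (ZSpan.isAddFundamentalDomain' (Pi.basisFun ℝ ι) volume)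
    (fun x hx ↦ by rw [hmem] at hx ⊢; simpa [Matrix.mulVec_neg] using hx) hconv (by
      rw [hvol, ZSpan.fundamentalDomain_pi_basisFun, volume_pi, Measure.pi_pi]
      simp only [Real.volume_Ico, sub_zero, ENNReal.ofReal_one, Finset.prod_const_one, one_mul,
        Module.finrank_fintype_fun_eq_card]
      rw [← ENNReal.ofReal_ofNat, ← ENNReal.ofReal_pow (by norm_num), Finset.prod_mul_distrib,
        Finset.prod_const, Finset.card_univ]
      have h2 : (0 : ℝ) < 2 ^ Fintype.card ι := by positivity
      refine (ENNReal.ofReal_lt_ofReal_iff ?_).2 ?_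
      · have := abs_pos.2 hA
        have := Finset.prod_pos fun i (_ : i ∈ Finset.univ) ↦ hc i
        positivity
      · rw [mul_left_comm, lt_mul_iff_one_lt_right h2, inv_mul_eq_div,
          one_lt_div (abs_pos.2 hA)]
        exact h)
  have hint : ∀ i, ∃ z : ℤ, (z : ℝ) = (x : ι → ℝ) i := fun i ↦ by
    have := ((Pi.basisFun ℝ ι).mem_span_iff_repr_mem ℤ (x : ι → ℝ)).1 x.2 i
    simpa using this
  choose p hp using hint
  have hpx : (fun j ↦ (p j : ℝ)) = (x : ι → ℝ) := funext hp
  refine ⟨p, ?_, ?_⟩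
  · rintro rfl
    apply hx0
    ext i
    simp [← hp i]
  · rw [hpx]
    exact (hmem _).1 hx

/-- The matrix of the linear forms `x ↦ ∑ x_i ξ ^ i` and `x ↦ x_i`, `i ≥ 1`. -/
def formMatrix (m : ℕ) (ξ : ℝ) : Matrix (Fin (m + 1)) (Fin (m + 1)) ℝ :=
  Matrix.of fun i k ↦ Fin.cases (ξ ^ (k : ℕ)) (fun j ↦ if j.succ = k then 1 else 0) i

theorem formMatrix_mulVec_zero (m : ℕ) (ξ : ℝ) (x : Fin (m + 1) → ℝ) :
    (formMatrix m ξ).mulVec x 0 = ∑ i, x i * ξ ^ (i : ℕ) := by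
  simp [formMatrix, Matrix.mulVec, dotProduct, mul_comm]

theorem formMatrix_mulVec_succ (m : ℕ) (ξ : ℝ) (x : Fin (m + 1) → ℝ) (j : Fin m) :
    (formMatrix m ξ).mulVec x j.succ = x j.succ := by
  simp [formMatrix, Matrix.mulVec, dotProduct]

theorem det_formMatrix (m : ℕ) (ξ : ℝ) : (formMatrix m ξ).det = 1 := by
  rw [Matrix.det_of_isUpperTriangular]
  · rw [Fin.prod_univ_succ]
    simp [formMatrix]
  · intro i k hik
    induction i using Fin.cases with
    | zero => simp at hik
    | succ j =>
      have : j.succ ≠ k := fun h ↦ by simp [h] at hik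
      simp [formMatrix, this]

/-- An integer polynomial of degree at most `m` with prescribed bounds, orthogonal to the rows of
an integer matrix `V` of full rank that are almost orthogonal to the relevant box. -/
theorem exists_int_coeffs_of_fullRank {m k : ℕ} (ξ : ℝ) (V : Matrix (Fin k) (Fin (m + 1)) ℤ)
    (hV : ∀ a, Matrix.vecMul a V = 0 → a = 0) {H δ T : ℝ} (hH : 0 < H) (hδ : 0 < δ) (hT : 0 < T)
    (hvol : 1 < δ * H ^ m * T ^ k)
    (hsmall : ∀ x : Fin (m + 1) → ℝ, |∑ i, x i * ξ ^ (i : ℕ)| < δ →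
      (∀ j : Fin m, |x j.succ| < H) →
        ∀ i, T * |(V.map (Int.cast : ℤ → ℝ)).mulVec x i| < 1) :
    ∃ p : Fin (m + 1) → ℤ, p ≠ 0 ∧ |∑ i, (p i : ℝ) * ξ ^ (i : ℕ)| < δ ∧
      ∀ j : Fin m, |(p j.succ : ℝ)| < H := by
  classical
  set W : Matrix (Fin k) (Fin (m + 1)) ℝ := V.map (Int.cast : ℤ → ℝ) with hW
  -- A left kernel vector `v` of the Gram matrix satisfies `|vV|² = 0`.
  have hgram : (V * V.transpose).det ≠ 0 := by
    intro h0
    obtain ⟨v, hv0, hv⟩ := Matrix.exists_vecMul_eq_zero_iff.2 h0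
    apply hv0
    apply hV
    have h1 : dotProduct (Matrix.vecMul v V) (Matrix.vecMul v V) = 0 := by
      have h2 : dotProduct (Matrix.vecMul v (V * V.transpose)) v = 0 := by rw [hv]; simp
      rw [← Matrix.vecMul_vecMul, ← Matrix.dotProduct_mulVec, Matrix.mulVec_transpose] at h2
      exact h2
    exact dotProduct_self_eq_zero.1 h1
  have hgramR : IsUnit (W * W.transpose).det := by
    have h1 : W * W.transpose = (V * V.transpose).map (Int.castRingHom ℝ) := by
      rw [Matrix.map_mul, Matrix.transpose_map]; rfl
    rw [h1, ← RingHom.mapMatrix_apply, ← RingHom.map_det, isUnit_iff_ne_zero]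
    simpa using hgram
  -- `M` below is the identity on `ker W` and multiplies the `k`-dimensional image of `B` by `T⁻¹`.
  -- Pulling the box back along `M` therefore stretches it by `T` in `k` directions.
  set c : ℝ := T⁻¹ - 1 with hc
  set B : Matrix (Fin (m + 1)) (Fin k) ℝ := W.transpose * (W * W.transpose)⁻¹ with hB
  have hWB : W * B = 1 := by
    rw [hB, ← Matrix.mul_assoc, Matrix.mul_nonsing_inv _ hgramR]
  set M : Matrix (Fin (m + 1)) (Fin (m + 1)) ℝ := 1 + (c • B) * W with hM
  have hMdet : M.det = T⁻¹ ^ k := by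
    rw [hM, Matrix.det_one_add_mul_comm, Matrix.mul_smul, hWB]
    have : (1 : Matrix (Fin k) (Fin k) ℝ) + c • 1 = T⁻¹ • 1 := by
      rw [hc, sub_smul]; simp
    rw [this, Matrix.det_smul]
    simp
  have hWM : W * M = T⁻¹ • W := by
    rw [hM, Matrix.mul_add, Matrix.mul_one, Matrix.smul_mul, Matrix.mul_smul, ← Matrix.mul_assoc,
      hWB, Matrix.one_mul, hc, sub_smul]
    simp
  have hdet : (formMatrix m ξ * M).det = T⁻¹ ^ k := by
    rw [Matrix.det_mul, det_formMatrix, hMdet, one_mul]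
  obtain ⟨p, hp0, hp⟩ := exists_int_forall_abs_mulVec_lt (formMatrix m ξ * M)
    (Fin.cases δ fun _ ↦ H) (fun i ↦ by cases i using Fin.cases <;> simpa) (by
      rw [hdet]; positivity) (by
      rw [hdet, abs_of_pos (by positivity), Fin.prod_univ_succ]
      simp only [Fin.cases_zero, Fin.cases_succ, Finset.prod_const, Finset.card_univ,
        Fintype.card_fin]
      rw [inv_pow, inv_lt_iff_one_lt_mul₀ (by positivity)]
      linarith)
  set x : Fin (m + 1) → ℝ := fun j ↦ (p j : ℝ) with hx
  have hq0 : |∑ i, M.mulVec x i * ξ ^ (i : ℕ)| < δ := by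
    have := hp 0
    rwa [← Matrix.mulVec_mulVec, formMatrix_mulVec_zero] at this
  have hqs : ∀ j : Fin m, |M.mulVec x j.succ| < H := fun j ↦ by
    have := hp j.succ
    rwa [← Matrix.mulVec_mulVec, formMatrix_mulVec_succ] at this
  -- `W x = T • W (M x)` with `M x` in the original box, so its entries are integers of absolute
  -- value below 1. Then `x` lies in `ker W`, where `M` is the identity, and the stretching is
  -- undone.
  have hWx : W.mulVec x = 0 := by
    funext i
    have h1 := hsmall _ hq0 hqs i
    rw [Matrix.mulVec_mulVec, hWM, Matrix.smul_mulVec, Pi.smul_apply, smul_eq_mul, abs_mul,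
      abs_of_pos (inv_pos.2 hT), mul_inv_cancel_left₀ hT.ne'] at h1
    have h2 : W.mulVec x i = ((V.mulVec p i : ℤ) : ℝ) := by
      simp [hW, hx, Matrix.mulVec, dotProduct]
    rw [h2] at h1 ⊢
    have h3 : |V.mulVec p i| < 1 := by exact_mod_cast h1
    simp [Int.abs_lt_one_iff.1 h3]
  have hMx : M.mulVec x = x := by
    rw [hM, Matrix.add_mulVec, Matrix.one_mulVec, ← Matrix.mulVec_mulVec, hWx]
    simp
  rw [hMx] at hq0 hqs
  exact ⟨p, hp0, hq0, hqs⟩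

/-- Dirichlet's theorem for linear forms in the powers of `ξ`. -/
theorem exists_int_coeffs (m : ℕ) (ξ : ℝ) {H δ : ℝ} (hH : 0 < H) (hδ : 0 < δ)
    (hvol : 1 < δ * H ^ m) :
    ∃ p : Fin (m + 1) → ℤ, p ≠ 0 ∧ |∑ i, (p i : ℝ) * ξ ^ (i : ℕ)| < δ ∧
      ∀ j : Fin m, |(p j.succ : ℝ)| < H :=
  exists_int_coeffs_of_fullRank (k := 0) ξ 0 (fun _ _ ↦ Subsingleton.elim _ _) hH hδ one_pos
    (by simpa using hvol) (fun _ _ _ i ↦ i.elim0)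

theorem linFormSolvable_of_coeffs {m : ℕ} {ξ w X : ℝ} (hw : 0 ≤ w) (hX : 1 ≤ X)
    {p : Fin (m + 1) → ℤ} (hp : p ≠ 0) (h0 : |∑ i, (p i : ℝ) * ξ ^ (i : ℕ)| < X ^ (-w))
    (hs : ∀ j : Fin m, |(p j.succ : ℝ)| < X) : LinFormSolvable m ξ w X := by
  refine ⟨p, ?_, fun j ↦ (hs j).le, h0.le⟩
  by_contra! hcon
  have hz : ∀ j : Fin m, p j.succ = 0 := fun j ↦ Int.abs_lt_one_iff.1 (hcon j)
  apply hp
  funext i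
  induction i using Fin.cases with
  | succ j => exact hz j
  | zero =>
    rw [Fin.sum_univ_succ] at h0
    simp only [hz, Fin.val_zero, pow_zero, mul_one, Int.cast_zero, zero_mul,
      Finset.sum_const_zero, add_zero] at h0
    have h1 : |(p 0 : ℝ)| < 1 := h0.trans_le (Real.rpow_le_one_of_one_le_of_nonpos hX (by linarith))
    exact Int.abs_lt_one_iff.1 (by exact_mod_cast h1)

theorem eventually_linFormSolvable_of_lt {m : ℕ} (ξ : ℝ) {w : ℝ} (hw : 0 ≤ w) (hwm : w < m) :
    ∀ᶠ X : ℝ in atTop, LinFormSolvable m ξ w X := by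
  filter_upwards [eventually_gt_atTop 1] with X hX
  have hX0 : 0 < X := by linarith
  obtain ⟨p, hp, h0, hs⟩ := exists_int_coeffs m ξ hX0 (Real.rpow_pos_of_pos hX0 (-w)) (by
    rw [← Real.rpow_natCast, ← Real.rpow_add hX0]
    exact Real.one_lt_rpow hX (by linarith))
  exact linFormSolvable_of_coeffs hw hX.le hp h0 hs

/-- The matrix of the linear forms `x ↦ x_0` and `x ↦ ξ ^ i x_0 - x_i`, `i ≥ 1`. -/
def simulMatrix (n : ℕ) (ξ : ℝ) : Matrix (Fin (n + 1)) (Fin (n + 1)) ℝ :=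
  Matrix.of fun i k ↦ Fin.cases (if k = 0 then 1 else 0)
    (fun j ↦ if k = 0 then ξ ^ ((j : ℕ) + 1) else if j.succ = k then -1 else 0) i

theorem simulMatrix_mulVec_zero (n : ℕ) (ξ : ℝ) (x : Fin (n + 1) → ℝ) :
    (simulMatrix n ξ).mulVec x 0 = x 0 := by
  simp [simulMatrix, Matrix.mulVec, dotProduct]

theorem simulMatrix_mulVec_succ (n : ℕ) (ξ : ℝ) (x : Fin (n + 1) → ℝ) (j : Fin n) :
    (simulMatrix n ξ).mulVec x j.succ = ξ ^ ((j : ℕ) + 1) * x 0 - x j.succ := by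
  rw [Matrix.mulVec, dotProduct, Fin.sum_univ_succ]
  simp [simulMatrix, Fin.succ_ne_zero, sub_eq_add_neg]

theorem abs_det_simulMatrix (n : ℕ) (ξ : ℝ) : |(simulMatrix n ξ).det| = 1 := by
  rw [Matrix.det_of_isLowerTriangular]
  · rw [Fin.prod_univ_succ]
    simp [simulMatrix, Fin.succ_ne_zero, abs_pow]
  · intro i k hik
    have hik : i < k := hik
    have hk : k ≠ 0 := fun h ↦ by simp [h] at hik
    induction i using Fin.cases with
    | zero => simp [simulMatrix, hk]
    | succ j => simp [simulMatrix, hk, hik.ne]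

theorem eventually_simulSolvable_of_lt {n : ℕ} (ξ : ℝ) {lam : ℝ} (h0 : 0 ≤ lam)
    (hlam : lam * n < 1) : ∀ᶠ X : ℝ in atTop, SimulSolvable n ξ lam X := by
  filter_upwards [eventually_gt_atTop 1] with X hX
  have hX0 : 0 < X := by linarith
  have hdet := abs_det_simulMatrix n ξ
  have hXl := Real.rpow_pos_of_pos hX0 (-lam)
  obtain ⟨p, hp0, hp⟩ := exists_int_forall_abs_mulVec_lt (simulMatrix n ξ)
    (Fin.cases X fun _ ↦ X ^ (-lam)) (fun i ↦ by cases i using Fin.cases <;> simpa)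
    (fun h ↦ by simp [h] at hdet) (by
      rw [hdet, Fin.prod_univ_succ]
      simp only [Fin.cases_zero, Fin.cases_succ, Finset.prod_const, Finset.card_univ,
        Fintype.card_fin]
      rw [← Real.rpow_natCast, ← Real.rpow_mul hX0.le, ← Real.rpow_one_add' hX0.le (by linarith)]
      exact Real.one_lt_rpow hX (by linarith))
  have hz := hp 0
  rw [simulMatrix_mulVec_zero] at hz
  have hs : ∀ j : Fin n, |ξ ^ ((j : ℕ) + 1) * (p 0 : ℝ) - p j.succ| < X ^ (-lam) := fun j ↦ by
    have := hp j.succ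
    rwa [simulMatrix_mulVec_succ] at this
  have hXl1 : X ^ (-lam) ≤ 1 := Real.rpow_le_one_of_one_le_of_nonpos hX.le (by linarith)
  have hp00 : p 0 ≠ 0 := by
    intro h
    apply hp0
    funext i
    induction i using Fin.cases with
    | zero => exact h
    | succ j =>
      have := (hs j).trans_le hXl1
      rw [h, Int.cast_zero, mul_zero, zero_sub, abs_neg] at this
      exact Int.abs_lt_one_iff.1 (by exact_mod_cast this)
  simp only [Fin.cases_zero] at hz
  rcases lt_or_gt_of_ne hp00 with h | h
  · refine ⟨-p 0, fun j ↦ -p j.succ, by omega, ?_, fun j ↦ ?_⟩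
    · push_cast
      linarith [neg_abs_le (p 0 : ℝ)]
    · have := (hs j).le
      rw [← abs_neg] at this
      rwa [show -(ξ ^ ((j : ℕ) + 1) * (p 0 : ℝ) - p j.succ) =
        ξ ^ ((j : ℕ) + 1) * ((-p 0 : ℤ) : ℝ) - ((-p j.succ : ℤ) : ℝ) by push_cast; ring] at this
  · exact ⟨p 0, fun j ↦ p j.succ, by omega, (le_abs_self _).trans hz.le, fun j ↦ (hs j).le⟩

theorem SimulSolvable.mono {n : ℕ} {ξ lam lam' X : ℝ} (hX : 1 ≤ X) (h : lam' ≤ lam)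
    (hs : SimulSolvable n ξ lam X) : SimulSolvable n ξ lam' X := by
  obtain ⟨x, y, h1, h2, h3⟩ := hs
  exact ⟨x, y, h1, h2, fun j ↦ (h3 j).trans (Real.rpow_le_rpow_of_exponent_le hX (by linarith))⟩

/-! ### Best denominators and the functionals they define on polynomials. -/

open Polynomial

/-- The nearest integer to `ξ ^ i q`. -/
noncomputable def apx (ξ : ℝ) (q i : ℕ) : ℤ := round (ξ ^ i * q)

/-- The quality `max_{1 ≤ i ≤ n} ‖ξ ^ i q‖` of the denominator `q`. -/
noncomputable def err (n : ℕ) (ξ : ℝ) (q : ℕ) : ℝ :=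
  ‖fun j : Fin n ↦ ξ ^ ((j : ℕ) + 1) * q - apx ξ q (j + 1)‖

theorem err_nonneg (n : ℕ) (ξ : ℝ) (q : ℕ) : 0 ≤ err n ξ q := norm_nonneg _

theorem abs_sub_apx_le {n : ℕ} (ξ : ℝ) (q : ℕ) {i : ℕ} (hi : i ≤ n) :
    |ξ ^ i * q - apx ξ q i| ≤ err n ξ q := by
  cases i with
  | zero => simpa [apx] using err_nonneg n ξ q
  | succ i =>
    exact norm_le_pi_norm (fun j : Fin n ↦ ξ ^ ((j : ℕ) + 1) * q - apx ξ q (j + 1)) ⟨i, hi⟩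

theorem SimulSolvable.exists_err_le {n : ℕ} {ξ lam X : ℝ} (hX : 0 < X)
    (h : SimulSolvable n ξ lam X) : ∃ q : ℕ, 1 ≤ q ∧ (q : ℝ) ≤ X ∧ err n ξ q ≤ X ^ (-lam) := by
  obtain ⟨x, y, h1, h2, h3⟩ := h
  lift x to ℕ using by omega
  refine ⟨x, by omega, by exact_mod_cast h2, ?_⟩
  refine (pi_norm_le_iff_of_nonneg (Real.rpow_nonneg hX.le _)).2 fun j ↦ ?_
  have := h3 j
  rw [Int.cast_natCast] at this
  exact (round_le _ _).trans this

/-- A denominator of minimal `err` among `1, …, N + 1`. -/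
noncomputable def best (n : ℕ) (ξ : ℝ) : ℕ → ℕ
  | 0 => 1
  | N + 1 => open Classical in if err n ξ (N + 2) < err n ξ (best n ξ N) then N + 2 else best n ξ N

theorem one_le_best (n : ℕ) (ξ : ℝ) (N : ℕ) : 1 ≤ best n ξ N := by
  induction N with
  | zero => simp [best]
  | succ N ih => rw [best]; split_ifs <;> omega

theorem best_le (n : ℕ) (ξ : ℝ) (N : ℕ) : best n ξ N ≤ N + 1 := by
  induction N with
  | zero => simp [best]
  | succ N ih => rw [best]; split_ifs <;> omega

theorem err_best_le (n : ℕ) (ξ : ℝ) (N : ℕ) {q : ℕ} (h1 : 1 ≤ q) (h2 : q ≤ N + 1) :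
    err n ξ (best n ξ N) ≤ err n ξ q := by
  induction N with
  | zero => simp [best, show q = 1 by omega]
  | succ N ih =>
    rw [best]
    rcases Nat.lt_or_ge q (N + 2) with h | h
    · have := ih (by omega)
      split_ifs with h'
      · exact h'.le.trans this
      · exact this
    · obtain rfl : q = N + 2 := by omega
      split_ifs with h'
      · exact le_rfl
      · exact not_lt.1 h'

/-- The linear functional on polynomials that sends `X ^ i` to the nearest integer to
`ξ ^ i q`. -/
noncomputable def evalApx (ξ : ℝ) (q : ℕ) : ℚ[X] →ₗ[ℚ] ℚ :=
  Polynomial.lsum fun i ↦ (apx ξ q i : ℚ) • LinearMap.id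

theorem evalApx_eq_sum (ξ : ℝ) (q : ℕ) {P : ℚ[X]} {d : ℕ} (hd : P.natDegree ≤ d) :
    evalApx ξ q P = ∑ i ∈ Finset.range (d + 1), P.coeff i * apx ξ q i := by
  rw [evalApx, Polynomial.lsum_apply, Polynomial.sum_over_range' _ (by simp) (d + 1) (by omega)]
  simp [mul_comm]

theorem exists_int_evalApx (ξ : ℝ) (q : ℕ) (P : ℤ[X]) :
    ∃ z : ℤ, evalApx ξ q (P.map (Int.castRingHom ℚ)) = z := by
  refine ⟨∑ i ∈ Finset.range (P.natDegree + 1), P.coeff i * apx ξ q i, ?_⟩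
  rw [evalApx_eq_sum ξ q natDegree_map_le]
  simp

theorem abs_evalApx_sub_le {n : ℕ} (ξ : ℝ) (q : ℕ) {P : ℚ[X]} (hP : P.natDegree ≤ n) {B : ℝ}
    (hB : ∀ i, |(P.coeff i : ℝ)| ≤ B) :
    |(evalApx ξ q P : ℝ) - q * aeval ξ P| ≤ (n + 1) * (B * err n ξ q) := by
  rw [evalApx_eq_sum ξ q hP, aeval_eq_sum_range' (Nat.lt_succ_of_le hP), Finset.mul_sum]
  push_cast
  rw [← Finset.sum_sub_distrib]
  refine (Finset.abs_sum_le_sum_abs _ _).trans ?_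
  refine (Finset.sum_le_card_nsmul _ _ (B * err n ξ q) fun i hi ↦ ?_).trans (by simp)
  rw [Finset.mem_range] at hi
  have h1 : (P.coeff i : ℝ) * apx ξ q i - q * (P.coeff i • ξ ^ i) =
      -(P.coeff i * (ξ ^ i * q - apx ξ q i)) := by
    rw [Rat.smul_def]; ring
  rw [h1, abs_neg, abs_mul]
  exact mul_le_mul (hB i) (abs_sub_apx_le ξ q (by omega)) (abs_nonneg _)
    ((abs_nonneg _).trans (hB i))

/-- The functional is close to `q` times evaluation at `ξ`. Since it is integral on integer
polynomials, a right-hand side below 1 forces it to vanish there. -/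
theorem abs_evalApx_mul_X_pow_le {n : ℕ} (ξ : ℝ) (q : ℕ) {P : ℚ[X]} {j : ℕ}
    (hP : P.natDegree + j ≤ n) {B : ℝ} (hB : ∀ i, |(P.coeff i : ℝ)| ≤ B) :
    |(evalApx ξ q (P * X ^ j) : ℝ)| ≤
      max 1 |ξ| ^ n * (q * |aeval ξ P|) + (n + 1) * (B * err n ξ q) := by
  have hB0 : 0 ≤ B := (abs_nonneg _).trans (hB 0)
  have h1 := abs_evalApx_sub_le (n := n) ξ q (P := P * X ^ j)
    (natDegree_mul_le.trans (by simpa using hP)) (B := B) (fun i ↦ by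
      rw [coeff_mul_X_pow']
      split_ifs
      · exact hB _
      · simpa using hB0)
  have h2 : |ξ| ^ j ≤ max 1 |ξ| ^ n :=
    (pow_le_pow_left₀ (abs_nonneg _) (le_max_right _ _) _).trans
      (pow_le_pow_right₀ (le_max_left _ _) (by omega))
  have h3 : |(q : ℝ) * aeval ξ (P * X ^ j)| ≤ max 1 |ξ| ^ n * (q * |aeval ξ P|) := by
    rw [map_mul, map_pow, aeval_X, abs_mul, abs_mul, abs_pow, Nat.abs_cast]
    calc (q : ℝ) * (|aeval ξ P| * |ξ| ^ j) = |ξ| ^ j * (q * |aeval ξ P|) := by ring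
      _ ≤ _ := by gcongr
  calc |(evalApx ξ q (P * X ^ j) : ℝ)|
      = |(q : ℝ) * aeval ξ (P * X ^ j) +
          ((evalApx ξ q (P * X ^ j) : ℝ) - q * aeval ξ (P * X ^ j))| := by congr 1; ring
    _ ≤ _ := (abs_add_le _ _).trans (add_le_add h3 h1)

/-! ### Greatest common divisors and coefficient bounds for divisors. -/

theorem map_mul_eq_zero_of_forall_X_pow {φ : ℚ[X] →ₗ[ℚ] ℚ} {P : ℚ[X]} {r : ℕ}
    (h : ∀ j ≤ r, φ (P * X ^ j) = 0) {A : ℚ[X]} (hA : A.natDegree ≤ r) : φ (P * A) = 0 := by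
  rw [A.as_sum_range' (r + 1) (by omega), Finset.mul_sum, map_sum]
  refine Finset.sum_eq_zero fun i hi ↦ ?_
  rw [← C_mul_X_pow_eq_monomial, mul_left_comm, ← smul_eq_C_mul, map_smul,
    h i (by rw [Finset.mem_range] at hi; omega), smul_zero]

/-- If a functional vanishes on the multiples of `P` and of `Q` in suitable degrees, then it
vanishes at their greatest common divisor. -/
theorem map_gcd_eq_zero {φ : ℚ[X] →ₗ[ℚ] ℚ} {P Q : ℚ[X]} {m r : ℕ} (hQ0 : Q ≠ 0)
    (hPm : P.natDegree ≤ m) (hQr : Q.natDegree ≤ r)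
    (hP : ∀ j ≤ r, φ (P * X ^ j) = 0) (hQ : ∀ j ≤ m, φ (Q * X ^ j) = 0) :
    φ (EuclideanDomain.gcd P Q) = 0 := by
  set G := EuclideanDomain.gcd P Q with hG
  have hG0 : G ≠ 0 := fun h ↦ hQ0 (EuclideanDomain.gcd_eq_zero_iff.1 h).2
  obtain ⟨P₁, hP₁⟩ := EuclideanDomain.gcd_dvd_left P Q
  obtain ⟨Q₁, hQ₁⟩ := EuclideanDomain.gcd_dvd_right P Q
  rw [← hG] at hP₁ hQ₁
  have hQ₁0 : Q₁ ≠ 0 := fun h ↦ hQ0 (by rw [hQ₁, h, mul_zero])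
  set a := EuclideanDomain.gcdA P Q
  set b := EuclideanDomain.gcdB P Q
  have hab : P₁ * a + Q₁ * b = 1 := by
    apply mul_left_cancel₀ hG0
    have := EuclideanDomain.gcd_eq_gcd_ab P Q
    rw [← hG] at this
    rw [mul_add, ← mul_assoc, ← mul_assoc, ← hP₁, ← hQ₁, mul_one]
    exact this.symm
  -- Reducing the Bézout cofactors gives degrees at most `deg Q₁ ≤ r` and `deg P₁ ≤ m`, within reach
  -- of the vanishing hypotheses.
  set a' := a % Q₁
  set b' := b + P₁ * (a / Q₁)
  have hab' : P₁ * a' + Q₁ * b' = 1 := by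
    rw [← hab]
    conv_rhs => rw [← EuclideanDomain.div_add_mod a Q₁]
    ring
  have hdega : a'.degree < Q₁.degree := EuclideanDomain.mod_lt a hQ₁0
  have hna : a'.natDegree ≤ Q₁.natDegree := natDegree_le_natDegree hdega.le
  have hnb : b'.natDegree ≤ P₁.natDegree := by
    by_cases hb0 : b' = 0
    · simp [hb0]
    have h1 : (Q₁ * b').natDegree ≤ P₁.natDegree + Q₁.natDegree := by
      rw [show Q₁ * b' = 1 - P₁ * a' by rw [← hab']; ring]
      refine (natDegree_sub_le _ _).trans (max_le (by simp) (natDegree_mul_le.trans (by omega)))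
    rw [natDegree_mul hQ₁0 hb0] at h1
    omega
  have hQ₁d : Q₁.natDegree ≤ r := (natDegree_le_of_dvd ⟨G, by rw [hQ₁]; ring⟩ hQ0).trans hQr
  have hP₁d : P₁.natDegree ≤ m := by
    by_cases hP0 : P = 0
    · have : P₁ = 0 := by
        rcases mul_eq_zero.1 (hP₁.symm.trans hP0) with h | h
        · exact absurd h hG0
        · exact h
      simp [this]
    · exact (natDegree_le_of_dvd ⟨G, by rw [hP₁]; ring⟩ hP0).trans hPm
  have hGe : G = P * a' + Q * b' := by
    rw [hP₁, hQ₁, mul_assoc, mul_assoc, ← mul_add, hab', mul_one]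
  rw [hGe, map_add, map_mul_eq_zero_of_forall_X_pow hP (hna.trans hQ₁d),
    map_mul_eq_zero_of_forall_X_pow hQ (hnb.trans hP₁d), add_zero]

/-- A nonzero rational polynomial is associated to a primitive integer polynomial. -/
theorem exists_isPrimitive_map_eq {G : ℚ[X]} (hG : G ≠ 0) :
    ∃ G' : ℤ[X], G'.IsPrimitive ∧ ∃ c : ℚ, c ≠ 0 ∧ G'.map (Int.castRingHom ℚ) = c • G := by
  obtain ⟨b, hb, hbG⟩ := IsLocalization.integerNormalization_spec (nonZeroDivisors ℤ) G
  set F := IsLocalization.integerNormalization (nonZeroDivisors ℤ) G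
  have hb0 : (b : ℚ) ≠ 0 := by exact_mod_cast nonZeroDivisors.ne_zero hb
  have hF0 : F ≠ 0 := by
    intro h
    rw [h, Polynomial.map_zero] at hbG
    have : (b : ℚ) • G = 0 := by rw [Int.cast_smul_eq_zsmul]; exact hbG.symm
    exact (smul_ne_zero hb0 hG) this
  have hc0 : (F.content : ℚ) ≠ 0 := by
    exact_mod_cast (content_eq_zero_iff.not.2 hF0)
  refine ⟨F.primPart, F.isPrimitive_primPart, (F.content : ℚ)⁻¹ * b,
    mul_ne_zero (inv_ne_zero hc0) hb0, ?_⟩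
  have h1 := congrArg (Polynomial.map (Int.castRingHom ℚ)) F.eq_C_content_mul_primPart
  rw [Polynomial.map_mul, map_C] at h1
  have h2 : F.map (Int.castRingHom ℚ) = (b : ℚ) • G := by
    rw [Int.cast_smul_eq_zsmul]; exact hbG
  rw [mul_smul, ← h2, h1, ← smul_eq_C_mul, smul_smul]
  simp [hc0]

/-- The coefficients of a divisor of an integer polynomial are bounded in terms of those of the
polynomial. -/
theorem abs_coeff_le_of_dvd {G P : ℤ[X]} (h : G ∣ P) (hP0 : P ≠ 0) {m : ℕ} (hm : P.natDegree ≤ m)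
    {B : ℝ} (hB : ∀ i, |(P.coeff i : ℝ)| ≤ B) (i : ℕ) :
    |(G.coeff i : ℝ)| ≤ 2 ^ m * ((m + 1) * B) := by
  obtain ⟨F, rfl⟩ := h
  have hF0 : F ≠ 0 := right_ne_zero_of_mul hP0
  have hG0 : G ≠ 0 := left_ne_zero_of_mul hP0
  have hB0 : 0 ≤ B := (abs_nonneg _).trans (hB 0)
  -- The cofactor `F` is a nonzero integer polynomial, so its Mahler measure is at least 1 and that
  -- of `G` is at most that of `G * F`.
  have h1 := norm_coeff_le_choose_mul_mahlerMeasure_of_one_le_mahlerMeasure i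
    (G.map (Int.castRingHom ℂ)) (F.map (Int.castRingHom ℂ)) (one_le_mahlerMeasure_of_ne_zero hF0)
  rw [← Polynomial.map_mul] at h1
  have hd : ((G * F).map (Int.castRingHom ℂ)).natDegree ≤ m := natDegree_map_le.trans hm
  have h2 : ((G * F).map (Int.castRingHom ℂ)).mahlerMeasure ≤ (m + 1) * B := by
    refine (mahlerMeasure_le_sum_norm_coeff _).trans ?_
    rw [Polynomial.sum_over_range' _ (by simp) (m + 1) (by omega)]
    refine (Finset.sum_le_card_nsmul _ _ B fun i _ ↦ ?_).trans (by simp)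
    rw [coeff_map]
    simpa using hB i
  have hdG : (G.map (Int.castRingHom ℂ)).natDegree ≤ m := by
    refine natDegree_map_le.trans (le_trans ?_ hm)
    exact natDegree_le_of_dvd (dvd_mul_right _ _) hP0
  have h3 : ((G.map (Int.castRingHom ℂ)).natDegree.choose i : ℝ) ≤ 2 ^ m := by
    refine le_trans ?_ (pow_le_pow_right₀ one_le_two hdG)
    exact_mod_cast Nat.choose_le_two_pow _ _
  have h4 : ‖(G.map (Int.castRingHom ℂ)).coeff i‖ = |(G.coeff i : ℝ)| := by simp
  rw [← h4]
  refine h1.trans (mul_le_mul h3 h2 (mahlerMeasure_nonneg _) (by positivity))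

/-- The box does not bound the constant coordinate directly; it is recovered from the linear form
and the other coordinates. -/
theorem abs_coord_le {m : ℕ} {ξ H δ : ℝ} {x : Fin (m + 1) → ℝ} (hδ : δ ≤ H)
    (h0 : |∑ i, x i * ξ ^ (i : ℕ)| < δ) (hs : ∀ j : Fin m, |x j.succ| < H) (i : Fin (m + 1)) :
    |x i| ≤ (1 + m * max 1 |ξ| ^ m) * H := by
  have hH : 0 < H := (abs_nonneg _).trans_lt (h0.trans_le hδ)
  have hΞ : 1 ≤ max 1 |ξ| ^ m := one_le_pow₀ (le_max_left _ _)
  induction i using Fin.cases with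
  | succ j =>
    refine (hs j).le.trans (le_mul_of_one_le_left hH.le ?_)
    have : (0 : ℝ) ≤ m * max 1 |ξ| ^ m := by positivity
    linarith
  | zero =>
    rw [Fin.sum_univ_succ] at h0
    simp only [Fin.val_zero, pow_zero, mul_one, Fin.val_succ] at h0
    have h1 : |∑ j : Fin m, x j.succ * ξ ^ ((j : ℕ) + 1)| ≤ m * (H * max 1 |ξ| ^ m) := by
      refine (Finset.abs_sum_le_sum_abs _ _).trans ?_
      refine (Finset.sum_le_card_nsmul _ _ (H * max 1 |ξ| ^ m) fun j _ ↦ ?_).trans (by simp)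
      rw [abs_mul, abs_pow]
      refine mul_le_mul (hs j).le ?_ (by positivity) hH.le
      exact (pow_le_pow_left₀ (abs_nonneg _) (le_max_right _ _) _).trans
        (pow_le_pow_right₀ (le_max_left _ _) (by omega))
    have h2 := abs_sub (x 0 + ∑ j : Fin m, x j.succ * ξ ^ ((j : ℕ) + 1))
      (∑ j : Fin m, x j.succ * ξ ^ ((j : ℕ) + 1))
    rw [add_sub_cancel_right] at h2
    nlinarith

/-- Dirichlet's theorem, stated for integer polynomials. -/
theorem exists_int_poly (m : ℕ) (ξ : ℝ) {σ ρ M : ℝ} (hM : 1 < M) (hσ : 0 ≤ σ) (hρ : 0 ≤ ρ)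
    (h : ρ < m * σ) :
    ∃ P : ℤ[X], P ≠ 0 ∧ P.natDegree ≤ m ∧ |aeval ξ P| < M ^ (-ρ) ∧
      ∀ i, |(P.coeff i : ℝ)| ≤ (1 + m * max 1 |ξ| ^ m) * M ^ σ := by
  have hM0 : 0 < M := by linarith
  obtain ⟨p, hp, h0, hs⟩ := exists_int_coeffs m ξ (Real.rpow_pos_of_pos hM0 σ)
    (Real.rpow_pos_of_pos hM0 (-ρ)) (by
      rw [← Real.rpow_natCast, ← Real.rpow_mul hM0.le, ← Real.rpow_add hM0]
      exact Real.one_lt_rpow hM (by linarith))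
  have hco : ∀ i : Fin (m + 1), (ofFn (m + 1) p).coeff i = p i := fun i ↦ by
    rw [ofFn_coeff_eq_val_of_lt _ i.2]
  have hdeg : (ofFn (m + 1) p).natDegree ≤ m := Nat.le_of_lt_succ (ofFn_natDegree_lt (by omega) p)
  refine ⟨ofFn (m + 1) p, ?_, hdeg, ?_, fun i ↦ ?_⟩
  · intro hz
    apply hp
    funext i
    rw [← hco i, hz]
    simp
  · rw [aeval_eq_sum_range' (Nat.lt_succ_of_le hdeg), Finset.sum_range]
    simpa [hco] using h0
  · rcases Nat.lt_or_ge i (m + 1) with hi | hi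
    · rw [hco ⟨i, hi⟩]
      refine abs_coord_le (x := fun i ↦ (p i : ℝ)) ?_ h0 hs ⟨i, hi⟩
      exact Real.rpow_le_rpow_of_exponent_le hM.le (by linarith)
    · rw [coeff_eq_zero_of_natDegree_lt (by omega)]
      simp only [Int.cast_zero, abs_zero]
      positivity

/-! ### Annihilating polynomials and their inheritance by earlier denominators. -/

theorem tendsto_natCast_rpow_zero {s : ℝ} (hs : s < 0) :
    Tendsto (fun M : ℕ ↦ (M : ℝ) ^ s) atTop (nhds 0) := by
  have := (tendsto_rpow_neg_atTop (neg_pos.2 hs)).comp tendsto_natCast_atTop_atTop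
  simpa [Function.comp_def] using this

theorem evalApx_map_mul_X_pow_eq_zero {ξ : ℝ} {q j : ℕ} {P : ℤ[X]}
    (h : |(evalApx ξ q (P.map (Int.castRingHom ℚ) * X ^ j) : ℝ)| < 1) :
    evalApx ξ q (P.map (Int.castRingHom ℚ) * X ^ j) = 0 := by
  obtain ⟨z, hz⟩ := exists_int_evalApx ξ q (P * X ^ j)
  rw [Polynomial.map_mul, Polynomial.map_pow, map_X] at hz
  rw [hz] at h ⊢
  have : |z| < 1 := by exact_mod_cast h
  simp [Int.abs_lt_one_iff.1 this]

theorem aeval_map_castRingHom (ξ : ℝ) (P : ℤ[X]) :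
    aeval ξ (P.map (Int.castRingHom ℚ)) = aeval ξ P :=
  aeval_map_algebraMap ℚ ξ P

/-- A small integer polynomial of degree `m` annihilates all good approximations. -/
theorem eventually_exists_annihilator {m r : ℕ} (ξ : ℝ) {lam : ℝ} (hlam : 1 < lam * m) {ε : ℝ}
    (hε : 0 < ε) : ∀ᶠ M : ℕ in atTop, ∃ P : ℤ[X], P ≠ 0 ∧ P.natDegree ≤ m ∧
      (∀ i, |(P.coeff i : ℝ)| ≤ ε * (M : ℝ) ^ lam) ∧
      ∀ q ≤ M + 1, err (m + r) ξ q ≤ (M : ℝ) ^ (-lam) →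
        ∀ j ≤ r, evalApx ξ q (P.map (Int.castRingHom ℚ) * X ^ j) = 0 := by
  have hm : (0 : ℝ) < m := by
    rcases Nat.eq_zero_or_pos m with rfl | h
    · norm_num at hlam
    · exact_mod_cast h
  -- Dirichlet is applied with height `M ^ σ` and value `M ^ (-ρ)`, `1 < ρ < σ * m`: `σ < lam` makes
  -- the coefficients `o(M ^ lam)`, and `ρ > 1` makes `q * P(ξ)` tend to 0.
  obtain ⟨σ, hσ1, hσ2⟩ := exists_between ((div_lt_iff₀ hm).2 hlam)
  rw [div_lt_iff₀ hm] at hσ1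
  have hσ0 : 0 < σ := by by_contra! h; nlinarith
  obtain ⟨ρ, hρ1, hρ2⟩ := exists_between hσ1
  set D : ℝ := 1 + m * max 1 |ξ| ^ m with hD
  set Ξ : ℝ := max 1 |ξ| ^ (m + r) with hΞ
  have hΞ1 : 1 ≤ Ξ := one_le_pow₀ (le_max_left _ _)
  set ε' : ℝ := min ε (1 / (2 * ((m + r : ℕ) + 1))) with hε'
  have hε'0 : 0 < ε' := lt_min hε (by positivity)
  have h1 : ∀ᶠ M : ℕ in atTop, D * (M : ℝ) ^ (σ - lam) < ε' := by
    have := (tendsto_natCast_rpow_zero (sub_neg.2 hσ2)).const_mul D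
    rw [mul_zero] at this
    exact this.eventually_lt_const hε'0
  have h2 : ∀ᶠ M : ℕ in atTop, (2 * Ξ) * (M : ℝ) ^ (1 - ρ) < 1 / 2 := by
    have := (tendsto_natCast_rpow_zero (sub_neg.2 hρ1)).const_mul (2 * Ξ)
    rw [mul_zero] at this
    exact this.eventually_lt_const (by norm_num)
  filter_upwards [h1, h2, eventually_gt_atTop 1] with M h1 h2 hM1
  have hM1' : (1 : ℝ) < M := by exact_mod_cast hM1
  have hM0 : (0 : ℝ) < M := by linarith
  have hMl : 0 < (M : ℝ) ^ lam := Real.rpow_pos_of_pos hM0 _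
  obtain ⟨P, hP0, hPd, hPξ, hPc⟩ := exists_int_poly m ξ hM1' hσ0.le (by linarith)
    (by linarith : ρ < m * σ)
  have hPc' : ∀ i, |(P.coeff i : ℝ)| ≤ ε' * (M : ℝ) ^ lam := fun i ↦ by
    refine (hPc i).trans ?_
    rw [Real.rpow_sub hM0, ← mul_div_assoc, div_lt_iff₀ hMl] at h1
    exact h1.le
  refine ⟨P, hP0, hPd, fun i ↦ (hPc' i).trans (by gcongr; exact min_le_left _ _),
    fun q hq hqe j hj ↦ ?_⟩
  apply evalApx_map_mul_X_pow_eq_zero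
  have h3 := abs_evalApx_mul_X_pow_le (n := m + r) ξ q (P := P.map (Int.castRingHom ℚ)) (j := j)
    (by have : (P.map (Int.castRingHom ℚ)).natDegree ≤ m := natDegree_map_le.trans hPd
        omega) (B := ε' * (M : ℝ) ^ lam) (fun i ↦ by simpa using hPc' i)
  rw [aeval_map_castRingHom] at h3
  refine h3.trans_lt ?_
  have hq' : (q : ℝ) ≤ 2 * M := by
    have : (q : ℝ) ≤ M + 1 := by exact_mod_cast hq
    linarith
  have h4 : Ξ * (q * |aeval ξ P|) < 1 / 2 := by
    calc Ξ * (q * |aeval ξ P|) ≤ Ξ * (2 * M * (M : ℝ) ^ (-ρ)) := by gcongr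
      _ = 2 * Ξ * (M : ℝ) ^ (1 - ρ) := by
        rw [Real.rpow_sub hM0, Real.rpow_neg hM0.le, Real.rpow_one]; ring
      _ < 1 / 2 := h2
  have h5 : ((m + r : ℕ) + 1 : ℝ) * (ε' * (M : ℝ) ^ lam * err (m + r) ξ q) ≤ 1 / 2 := by
    have h6 : ε' * (M : ℝ) ^ lam * err (m + r) ξ q ≤ ε' := by
      calc ε' * (M : ℝ) ^ lam * err (m + r) ξ q
          ≤ ε' * (M : ℝ) ^ lam * (M : ℝ) ^ (-lam) := by gcongr
        _ = ε' := by rw [mul_assoc, ← Real.rpow_add hM0]; simp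
    calc ((m + r : ℕ) + 1 : ℝ) * (ε' * (M : ℝ) ^ lam * err (m + r) ξ q)
        ≤ ((m + r : ℕ) + 1 : ℝ) * (1 / (2 * ((m + r : ℕ) + 1))) := by
          gcongr
          exact h6.trans (min_le_right _ _)
      _ = 1 / 2 := by field_simp
  linarith

/-- A polynomial of degree at most `r` that annihilates the new denominator `M + 1` annihilates
every earlier good denominator. -/
theorem eventually_annihilates_previous {m r : ℕ} (ξ : ℝ) {lam : ℝ} (hlam : 1 < lam * m) :
    ∀ᶠ M : ℕ in atTop, ∀ q ≤ M, err (m + r) ξ q ≤ (M : ℝ) ^ (-lam) →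
      err (m + r) ξ (M + 1) ≤ (M : ℝ) ^ (-lam) → ∀ Q : ℚ[X], Q.natDegree ≤ r →
        (∀ j ≤ m, evalApx ξ (M + 1) (Q * X ^ j) = 0) → ∀ j ≤ m, evalApx ξ q (Q * X ^ j) = 0 := by
  set Ξ : ℝ := max 1 |ξ| ^ (m + r) with hΞ
  have hΞ1 : 1 ≤ Ξ := one_le_pow₀ (le_max_left _ _)
  -- `E` absorbs the factor `2 ^ m * (m + 1)` lost in passing from `P` to a divisor, so that both
  -- terms of the final estimate for `G` sum to at most 1/2.
  set E : ℝ := (Ξ + 1) * ((m + r : ℕ) + 1) * (2 ^ m * (m + 1)) with hE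
  have hE0 : 0 < E := by positivity
  filter_upwards [eventually_exists_annihilator (r := r) ξ hlam
    (show 0 < 1 / (2 * E) by positivity), eventually_gt_atTop 0] with M hM hMpos
    q hq hqe hMe Q hQr hQ j hj
  by_cases hQ0 : Q = 0
  · simp [hQ0]
  have hM0 : (0 : ℝ) < M := by exact_mod_cast hMpos
  obtain ⟨P, hP0, hPd, hPc, hP⟩ := hM
  have hPd' : (P.map (Int.castRingHom ℚ)).natDegree ≤ m := natDegree_map_le.trans hPd
  have hgcd := map_gcd_eq_zero hQ0 hPd' hQr (hP (M + 1) le_rfl hMe) hQ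
  set G₀ := EuclideanDomain.gcd (P.map (Int.castRingHom ℚ)) Q with hG₀
  have hG₀0 : G₀ ≠ 0 := fun h ↦ hQ0 (EuclideanDomain.gcd_eq_zero_iff.1 h).2
  -- Primitivity gives divisibility of `P` over the integers (Gauss), hence small coefficients for
  -- `G`.
  obtain ⟨G, hGprim, c, hc0, hGc⟩ := exists_isPrimitive_map_eq hG₀0
  have hGd : ∀ F : ℚ[X], G₀ ∣ F → G.map (Int.castRingHom ℚ) ∣ F := fun F hF ↦ by
    rw [hGc, smul_eq_C_mul]
    exact (IsUnit.mul_left_dvd (isUnit_C.2 (isUnit_iff_ne_zero.2 hc0))).2 hF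
  have hGP : G ∣ P := (IsPrimitive.Int.dvd_iff_map_cast_dvd_map_cast G P hGprim).2
    (hGd _ (EuclideanDomain.gcd_dvd_left _ _))
  have hGm : (G.map (Int.castRingHom ℚ)).natDegree ≤ m :=
    natDegree_map_le.trans ((natDegree_le_of_dvd hGP hP0).trans hPd)
  have hG0 : evalApx ξ (M + 1) (G.map (Int.castRingHom ℚ)) = 0 := by
    rw [hGc, map_smul, hgcd, smul_zero]
  set B : ℝ := 2 ^ m * ((m + 1) * (1 / (2 * E) * (M : ℝ) ^ lam)) with hB
  have hBc : ∀ i, |(((G.map (Int.castRingHom ℚ)).coeff i : ℚ) : ℝ)| ≤ B := fun i ↦ by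
    rw [coeff_map, eq_intCast, Rat.cast_intCast]
    exact abs_coeff_le_of_dvd hGP hP0 hPd hPc i
  have hB0 : 0 ≤ B := by positivity
  have hBe : ∀ q', err (m + r) ξ q' ≤ (M : ℝ) ^ (-lam) →
      ((m + r : ℕ) + 1 : ℝ) * (B * err (m + r) ξ q') ≤ 1 / (2 * (Ξ + 1)) := fun q' hq' ↦ by
    calc ((m + r : ℕ) + 1 : ℝ) * (B * err (m + r) ξ q')
        ≤ ((m + r : ℕ) + 1 : ℝ) * (B * (M : ℝ) ^ (-lam)) := by gcongr
      _ = ((m + r : ℕ) + 1 : ℝ) * (2 ^ m * ((m + 1) * (1 / (2 * E)))) *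
            ((M : ℝ) ^ lam * (M : ℝ) ^ (-lam)) := by rw [hB]; ring
      _ = 1 / (2 * (Ξ + 1)) := by
        rw [← Real.rpow_add hM0, add_neg_cancel, Real.rpow_zero, hE]
        field_simp
  -- Exact vanishing at the denominator `M + 1` makes `G(ξ)` small enough for every `q ≤ M`; all
  -- admissible shifts of `G`, and hence its multiple `Q`, then vanish at `q`.
  have hGξ : ((M + 1 : ℕ) : ℝ) * |aeval ξ (G.map (Int.castRingHom ℚ))| ≤ 1 / (2 * (Ξ + 1)) := by
    have := abs_evalApx_sub_le (n := m + r) ξ (M + 1) (hGm.trans (by omega)) hBc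
    rw [hG0, Rat.cast_zero, zero_sub, abs_neg, abs_mul, Nat.abs_cast] at this
    exact this.trans (hBe _ hMe)
  have hGq : ∀ i ≤ m + r - (G.map (Int.castRingHom ℚ)).natDegree,
      evalApx ξ q (G.map (Int.castRingHom ℚ) * X ^ i) = 0 := fun i hi ↦ by
    apply evalApx_map_mul_X_pow_eq_zero
    refine (abs_evalApx_mul_X_pow_le (n := m + r) ξ q (by omega) hBc).trans_lt ?_
    have h1 : (q : ℝ) * |aeval ξ (G.map (Int.castRingHom ℚ))| ≤ 1 / (2 * (Ξ + 1)) :=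
      le_trans (by gcongr; omega) hGξ
    calc Ξ * (q * |aeval ξ (G.map (Int.castRingHom ℚ))|) +
          ((m + r : ℕ) + 1) * (B * err (m + r) ξ q)
        ≤ Ξ * (1 / (2 * (Ξ + 1))) + 1 / (2 * (Ξ + 1)) := by
          gcongr
          exact hBe _ hqe
      _ = 1 / 2 := by field_simp
      _ < 1 := by norm_num
  obtain ⟨A, hA⟩ := hGd Q (EuclideanDomain.gcd_dvd_right _ _)
  have hGA : G.map (Int.castRingHom ℚ) ≠ 0 ∧ A ≠ 0 := mul_ne_zero_iff.1 (hA ▸ hQ0)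
  have hdeg := natDegree_mul hGA.1 hGA.2
  rw [← hA] at hdeg
  rw [hA, mul_assoc]
  refine map_mul_eq_zero_of_forall_X_pow hGq (natDegree_mul_le.trans ?_)
  rw [natDegree_X_pow]
  omega

/-! ### Nondegeneracy of the Hankel matrices and the Davenport-Schmidt bound. -/

/-- The polynomials of degree at most `r` that annihilate the windows of length `r + 1` of the
approximation with denominator `q`. -/
noncomputable def annihilators (ξ : ℝ) (m r q : ℕ) : Submodule ℚ (degreeLT ℚ (r + 1)) where
  carrier := {Q | ∀ j ≤ m, evalApx ξ q ((Q : ℚ[X]) * X ^ j) = 0}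
  add_mem' ha hb j hj := by
    simp only [Set.mem_ofPred_eq] at ha hb
    simp [add_mul, ha j hj, hb j hj]
  zero_mem' j _ := by simp
  smul_mem' c Q hQ j hj := by
    simp only [Set.mem_ofPred_eq] at hQ
    simp [hQ j hj]

theorem mem_annihilators {ξ : ℝ} {m r q : ℕ} {Q : degreeLT ℚ (r + 1)} :
    Q ∈ annihilators ξ m r q ↔ ∀ j ≤ m, evalApx ξ q ((Q : ℚ[X]) * X ^ j) = 0 := Iff.rfl

theorem natDegree_le_of_degreeLT {r : ℕ} (Q : degreeLT ℚ (r + 1)) : (Q : ℚ[X]).natDegree ≤ r := by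
  by_cases hQ : (Q : ℚ[X]) = 0
  · simp [hQ]
  · exact Nat.le_of_lt_succ ((natDegree_lt_iff_degree_lt hQ).2 (mem_degreeLT.1 Q.2))

theorem eventually_err_best_le {n : ℕ} {ξ lam : ℝ}
    (hs : ∀ᶠ X : ℝ in atTop, SimulSolvable n ξ lam X) :
    ∀ᶠ N : ℕ in atTop, err n ξ (best n ξ N) ≤ ((N + 1 : ℕ) : ℝ) ^ (-lam) := by
  have := (tendsto_natCast_atTop_atTop (R := ℝ)).comp (tendsto_add_atTop_nat 1)
  filter_upwards [this.eventually hs] with N hN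
  obtain ⟨q, hq1, hq2, hq3⟩ := SimulSolvable.exists_err_le (by simp; positivity) hN
  exact (err_best_le n ξ N hq1 (Nat.cast_le.1 hq2)).trans hq3

/-- The spaces decrease along the best denominators and stabilise by finite dimension. A fixed `Q`
in the limit space satisfies `|Q(ξ)| ≤ C * err` for all later denominators, so `Q(ξ) = 0`, and
transcendence gives `Q = 0`. -/
theorem eventually_annihilators_eq_bot {m r : ℕ} {ξ lam : ℝ} (hξ : Transcendental ℚ ξ)
    (hlam : 1 < lam * m) (hs : ∀ᶠ X : ℝ in atTop, SimulSolvable (m + r) ξ lam X) :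
    ∀ᶠ N : ℕ in atTop, annihilators ξ m r (best (m + r) ξ N) = ⊥ := by
  have hlam0 : 0 < lam := by
    by_contra! h
    have : lam * m ≤ 0 := mul_nonpos_of_nonpos_of_nonneg h (Nat.cast_nonneg _)
    linarith
  have hle : ∀ᶠ N : ℕ in atTop, annihilators ξ m r (best (m + r) ξ (N + 1)) ≤
      annihilators ξ m r (best (m + r) ξ N) := by
    filter_upwards [eventually_err_best_le hs,
      (tendsto_add_atTop_nat 1).eventually (eventually_annihilates_previous (r := r) ξ hlam)]
      with N hN1 hN2
    rw [best]
    split_ifs with h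
    · intro Q hQ
      exact hN2 _ (best_le _ _ _) hN1 (h.le.trans hN1) Q (natDegree_le_of_degreeLT Q) hQ
    · exact le_rfl
  obtain ⟨N₀, hN₀⟩ := eventually_atTop.1 (hle.and (eventually_err_best_le hs))
  have hanti : Antitone fun N ↦ annihilators ξ m r (best (m + r) ξ (N₀ + N)) :=
    antitone_nat_of_succ_le fun N ↦ (hN₀ (N₀ + N) (by omega)).1
  have : Module.Finite ℚ (degreeLT ℚ (r + 1)) :=
    Module.Finite.equiv (degreeLTEquiv ℚ (r + 1)).symm
  obtain ⟨k, hk⟩ := IsArtinian.monotone_stabilizes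
    (⟨fun N ↦ OrderDual.toDual (annihilators ξ m r (best (m + r) ξ (N₀ + N))), hanti⟩ :
      ℕ →o (Submodule ℚ (degreeLT ℚ (r + 1)))ᵒᵈ)
  have hk' : ∀ N, k ≤ N → annihilators ξ m r (best (m + r) ξ (N₀ + k)) =
      annihilators ξ m r (best (m + r) ξ (N₀ + N)) := hk
  have hbot : annihilators ξ m r (best (m + r) ξ (N₀ + k)) = ⊥ := by
    refine (Submodule.eq_bot_iff _).2 fun Q hQ ↦ ?_
    set B : ℝ := ∑ i ∈ (Q : ℚ[X]).support, |((Q : ℚ[X]).coeff i : ℝ)| with hB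
    have hBc : ∀ i, |((Q : ℚ[X]).coeff i : ℝ)| ≤ B := fun i ↦ by
      by_cases hi : i ∈ (Q : ℚ[X]).support
      · exact Finset.single_le_sum (f := fun i ↦ |((Q : ℚ[X]).coeff i : ℝ)|)
          (fun _ _ ↦ abs_nonneg _) hi
      · rw [notMem_support_iff.1 hi, Rat.cast_zero, abs_zero]
        exact Finset.sum_nonneg fun _ _ ↦ abs_nonneg _
    have hB0 : 0 ≤ B := (abs_nonneg _).trans (hBc 0)
    have hsm : ∀ N, k ≤ N → |aeval ξ (Q : ℚ[X])| ≤
        ((m + r : ℕ) + 1) * B * ((N₀ + N + 1 : ℕ) : ℝ) ^ (-lam) := fun N hN ↦ by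
      have hQN := hk' N hN ▸ hQ
      have h0 := mem_annihilators.1 hQN 0 (Nat.zero_le _)
      rw [pow_zero, mul_one] at h0
      have h1 := abs_evalApx_sub_le (n := m + r) ξ (best (m + r) ξ (N₀ + N))
        ((natDegree_le_of_degreeLT Q).trans (by omega)) hBc
      rw [h0, Rat.cast_zero, zero_sub, abs_neg, abs_mul, Nat.abs_cast] at h1
      have h2 : (1 : ℝ) ≤ best (m + r) ξ (N₀ + N) := by exact_mod_cast one_le_best _ _ _
      calc |aeval ξ (Q : ℚ[X])| ≤ best (m + r) ξ (N₀ + N) * |aeval ξ (Q : ℚ[X])| :=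
            le_mul_of_one_le_left (abs_nonneg _) h2
        _ ≤ _ := h1
        _ ≤ ((m + r : ℕ) + 1) * (B * ((N₀ + N + 1 : ℕ) : ℝ) ^ (-lam)) := by
          gcongr
          exact (hN₀ (N₀ + N) (by omega)).2
        _ = _ := by ring
    have hlim : Tendsto (fun N : ℕ ↦ ((m + r : ℕ) + 1) * B * ((N₀ + N + 1 : ℕ) : ℝ) ^ (-lam))
        atTop (nhds 0) := by
      have h3 : Tendsto (fun N : ℕ ↦ N₀ + N + 1) atTop atTop :=
        tendsto_atTop_mono (fun N ↦ by rw [id]; omega) tendsto_id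
      have := ((tendsto_natCast_rpow_zero (neg_neg_of_pos hlam0)).comp h3).const_mul
        (((m + r : ℕ) + 1) * B)
      simpa using this
    have hz : |aeval ξ (Q : ℚ[X])| ≤ 0 :=
      ge_of_tendsto hlim (eventually_atTop.2 ⟨k, hsm⟩)
    have hz' : aeval ξ (Q : ℚ[X]) = 0 := abs_nonpos_iff.1 hz
    by_contra hQ0
    exact hξ ⟨Q, fun h ↦ hQ0 (Subtype.ext h), hz'⟩
  refine eventually_atTop.2 ⟨N₀ + k, fun N hN ↦ ?_⟩
  rw [← hbot, hk' (N - N₀) (by omega), show N₀ + (N - N₀) = N by omega]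

/-- The Davenport-Schmidt bound for uniform simultaneous approximation to powers. -/
theorem lam_mul_le_one {m r : ℕ} {ξ lam : ℝ} (hξ : Transcendental ℚ ξ) (hmr : m ≤ r)
    (hs : ∀ᶠ X : ℝ in atTop, SimulSolvable (m + r) ξ lam X) : lam * m ≤ 1 := by
  by_contra! hlam
  obtain ⟨N, h1, h2, P, hP0, hPd, -, hP⟩ := ((eventually_annihilators_eq_bot hξ hlam hs).and
    ((eventually_err_best_le hs).and ((tendsto_add_atTop_nat 1).eventually
      (eventually_exists_annihilator (r := r) ξ hlam one_pos)))).exists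
  have hmem : P.map (Int.castRingHom ℚ) ∈ degreeLT ℚ (r + 1) :=
    mem_degreeLT.2 ((degree_le_of_natDegree_le (natDegree_map_le.trans (hPd.trans hmr))).trans_lt
      (by exact_mod_cast Nat.lt_succ_self r))
  -- Because `m ≤ r`, the Dirichlet polynomial itself is a nonzero annihilator.
  have hz : (⟨_, hmem⟩ : degreeLT ℚ (r + 1)) ∈ annihilators ξ m r (best (m + r) ξ N) :=
    fun j hj ↦ hP _ ((best_le _ _ _).trans (by omega)) h2 j (hj.trans hmr)
  rw [h1, Submodule.mem_bot, Subtype.ext_iff] at hz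
  exact hP0 ((Polynomial.map_eq_zero_iff (RingHom.injective_int _)).1 hz)

/-! ### Windows and the transference in fixed dimension. -/

theorem evalApx_mul_X_pow (ξ : ℝ) (q j : ℕ) {Q : ℚ[X]} {d : ℕ} (hd : Q.natDegree ≤ d) :
    evalApx ξ q (Q * X ^ j) = ∑ i ∈ Finset.range (d + 1), Q.coeff i * apx ξ q (i + j) := by
  conv_lhs => rw [Q.as_sum_range' (d + 1) (by omega), Finset.sum_mul, map_sum]
  refine Finset.sum_congr rfl fun i _ ↦ ?_
  rw [monomial_mul_X_pow, evalApx, lsum_apply, sum_monomial_index _ _ (by simp)]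
  simp [mul_comm]

/-- The matrix whose rows are the windows of length `m + 1` of the approximation with
denominator `q`. -/
noncomputable def windows (ξ : ℝ) (m r q : ℕ) : Matrix (Fin (r + 1)) (Fin (m + 1)) ℤ :=
  Matrix.of fun j i ↦ apx ξ q (j + i)

/-- A left kernel vector of the Hankel matrix is the coefficient vector of an annihilator. -/
theorem eq_zero_of_vecMul_windows {ξ : ℝ} {m r q : ℕ} (h : annihilators ξ m r q = ⊥)
    (a : Fin (r + 1) → ℤ) (ha : Matrix.vecMul a (windows ξ m r q) = 0) : a = 0 := by
  set b : Fin (r + 1) → ℚ := fun i ↦ a i with hb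
  have hmem : ofFn (r + 1) b ∈ degreeLT ℚ (r + 1) := mem_degreeLT.2 (ofFn_degree_lt _)
  have hQ : (⟨_, hmem⟩ : degreeLT ℚ (r + 1)) ∈ annihilators ξ m r q := by
    intro j hj
    have h1 := congrFun ha ⟨j, by omega⟩
    simp only [Matrix.vecMul, dotProduct, windows, Matrix.of_apply, Pi.zero_apply] at h1
    rw [evalApx_mul_X_pow ξ q j (d := r) (Nat.le_of_lt_succ (ofFn_natDegree_lt (by omega) b)),
      Finset.sum_range]
    have h2 : ∀ i : Fin (r + 1), (ofFn (r + 1) b).coeff i = a i := fun i ↦ by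
      rw [ofFn_coeff_eq_val_of_lt _ i.2]
    simp only [h2]
    exact_mod_cast h1
  rw [h, Submodule.mem_bot, Subtype.ext_iff] at hQ
  funext i
  have h3 : (ofFn (r + 1) b).coeff i = 0 := by
    rw [show ofFn (r + 1) b = 0 from hQ, coeff_zero]
  rw [ofFn_coeff_eq_val_of_lt _ i.2] at h3
  simpa [hb] using h3

theorem abs_windows_mulVec_le {ξ : ℝ} {m r q : ℕ} {H δ : ℝ} {x : Fin (m + 1) → ℝ} (hδ : δ ≤ H)
    (h0 : |∑ i, x i * ξ ^ (i : ℕ)| < δ) (hs : ∀ j : Fin m, |x j.succ| < H) (k : Fin (r + 1)) :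
    |((windows ξ m r q).map (Int.cast : ℤ → ℝ)).mulVec x k| ≤
      max 1 |ξ| ^ r * (q * δ) +
        (m + 1) * ((1 + m * max 1 |ξ| ^ m) * H * err (m + r) ξ q) := by
  have h1 : ((windows ξ m r q).map (Int.cast : ℤ → ℝ)).mulVec x k =
      ξ ^ (k : ℕ) * (q * ∑ i, x i * ξ ^ (i : ℕ)) -
        ∑ i : Fin (m + 1), x i * (ξ ^ ((k : ℕ) + i) * q - apx ξ q (k + i)) := by
    simp only [Matrix.mulVec, dotProduct, windows, Matrix.map_apply, Matrix.of_apply,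
      Finset.mul_sum]
    rw [← Finset.sum_sub_distrib]
    refine Finset.sum_congr rfl fun i _ ↦ ?_
    ring
  rw [h1]
  refine (abs_sub _ _).trans (add_le_add ?_ ?_)
  · rw [abs_mul, abs_mul, abs_pow, Nat.abs_cast]
    have : |ξ| ^ (k : ℕ) ≤ max 1 |ξ| ^ r :=
      (pow_le_pow_left₀ (abs_nonneg _) (le_max_right _ _) _).trans
        (pow_le_pow_right₀ (le_max_left _ _) (by omega))
    gcongr
  · refine (Finset.abs_sum_le_sum_abs _ _).trans ?_
    refine (Finset.sum_le_card_nsmul _ _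
      ((1 + m * max 1 |ξ| ^ m) * H * err (m + r) ξ q) fun i _ ↦ ?_).trans (by simp)
    rw [abs_mul]
    have hx := abs_coord_le hδ h0 hs i
    exact mul_le_mul hx (abs_sub_apx_le ξ q (by omega)) (abs_nonneg _) ((abs_nonneg _).trans hx)

theorem tendsto_rpow_zero {s : ℝ} (hs : s < 0) : Tendsto (fun Y : ℝ ↦ Y ^ s) atTop (nhds 0) := by
  simpa using tendsto_rpow_neg_atTop (neg_pos.2 hs)

/-- Transference from uniform simultaneous approximation in dimension `m + r` to uniform linear
forms in dimension `m`. -/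
theorem eventually_linFormSolvable_of_simulSolvable {m r : ℕ} {ξ lam w : ℝ}
    (hξ : Transcendental ℚ ξ) (hlam : 1 < lam * m) (hw0 : 0 ≤ w)
    (hw : w * (1 - lam * r) < m - r + lam * m - 1)
    (hs : ∀ᶠ X : ℝ in atTop, SimulSolvable (m + r) ξ lam X) :
    ∀ᶠ Y : ℝ in atTop, LinFormSolvable m ξ w Y := by
  have hlam0 : 0 < lam := by
    by_contra! h
    have : lam * m ≤ 0 := mul_nonpos_of_nonpos_of_nonneg h (Nat.cast_nonneg _)
    linarith
  have hl1 : 0 < 1 + lam := by linarith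
  have hr1 : (0 : ℝ) < r + 1 := by positivity
  -- The stretching factor is `Y ^ θ`: the lower bound is the volume condition, the upper one keeps
  -- the products with the windows below 1. Compatibility of the two is exactly `hw`.
  obtain ⟨θ, hθ1, hθ2⟩ : ∃ θ, (w - m) / (r + 1) < θ ∧ θ < (lam * w - 1) / (1 + lam) := by
    apply exists_between
    rw [div_lt_div_iff₀ hr1 hl1]
    linarith
  rw [div_lt_iff₀ hr1] at hθ1
  -- The range `q ≤ Y ^ κ` balances the two error terms `q * Y ^ (-w)` and `Y * err`: `κ - w = 1 - κ
  -- * lam`.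
  set κ : ℝ := (w + 1) / (1 + lam) with hκ
  have hκ0 : 0 < κ := by positivity
  have hκw : κ - w = -((lam * w - 1) / (1 + lam)) := by rw [hκ]; field_simp; ring
  have hκl : 1 - κ * lam = -((lam * w - 1) / (1 + lam)) := by rw [hκ]; field_simp; ring
  set η : ℝ := θ - (lam * w - 1) / (1 + lam) with hη
  have hη0 : η < 0 := by rw [hη]; linarith
  set Ξ : ℝ := max 1 |ξ| ^ r with hΞ
  set D : ℝ := (m + 1) * (1 + m * max 1 |ξ| ^ m) with hD
  have hD0 : 0 < D := by positivity
  -- The shift by 1 matches `best _ _ N`, which searches up to `N + 1`.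
  have hfloor : Tendsto (fun Y : ℝ ↦ ⌊Y ^ κ⌋₊ - 1) atTop atTop :=
    (tendsto_sub_atTop_nat 1).comp (tendsto_nat_floor_atTop.comp (tendsto_rpow_atTop hκ0))
  have hsmall : ∀ᶠ Y : ℝ in atTop, (Ξ + D * 2 ^ lam) * Y ^ η < 1 := by
    have := (tendsto_rpow_zero hη0).const_mul (Ξ + D * 2 ^ lam)
    rw [mul_zero] at this
    exact this.eventually_lt_const one_pos
  filter_upwards [hsmall, eventually_gt_atTop 1,
    hfloor.eventually (eventually_annihilators_eq_bot hξ hlam hs),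
    hfloor.eventually (eventually_err_best_le hs)] with Y hY hY1 hbot herr
  have hY0 : 0 < Y := by linarith
  have hYκ : 1 < Y ^ κ := Real.one_lt_rpow hY1 hκ0
  have hfl : 1 ≤ ⌊Y ^ κ⌋₊ := Nat.one_le_floor_iff _ |>.2 hYκ.le
  rw [Nat.sub_add_cancel hfl] at herr
  set q := best (m + r) ξ (⌊Y ^ κ⌋₊ - 1) with hq
  have hqY : (q : ℝ) ≤ Y ^ κ := by
    have h1 : q ≤ ⌊Y ^ κ⌋₊ := (best_le _ _ _).trans (by omega)
    exact (Nat.cast_le.2 h1).trans (Nat.floor_le (by positivity))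
  have herr' : err (m + r) ξ q ≤ 2 ^ lam * Y ^ (-(κ * lam)) := by
    refine herr.trans ?_
    have h1 : Y ^ κ / 2 ≤ (⌊Y ^ κ⌋₊ : ℝ) := by
      have h2 := Nat.lt_floor_add_one (Y ^ κ)
      have h3 : (1 : ℝ) ≤ ⌊Y ^ κ⌋₊ := by exact_mod_cast hfl
      linarith
    calc (⌊Y ^ κ⌋₊ : ℝ) ^ (-lam) ≤ (Y ^ κ / 2) ^ (-lam) :=
          Real.rpow_le_rpow_of_nonpos (by positivity) h1 (by linarith)
      _ = 2 ^ lam * Y ^ (-(κ * lam)) := by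
        rw [Real.div_rpow (by positivity) (by norm_num), ← Real.rpow_mul hY0.le, mul_neg,
          Real.rpow_neg (by norm_num : (0 : ℝ) ≤ 2), div_inv_eq_mul, mul_comm]
  obtain ⟨p, hp, h0, hps⟩ := exists_int_coeffs_of_fullRank ξ (windows ξ m r q)
    (eq_zero_of_vecMul_windows hbot) hY0 (Real.rpow_pos_of_pos hY0 (-w))
    (Real.rpow_pos_of_pos hY0 θ) (by
      rw [← Real.rpow_natCast, ← Real.rpow_natCast, ← Real.rpow_mul hY0.le,
        ← Real.rpow_add hY0, ← Real.rpow_add hY0]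
      refine Real.one_lt_rpow hY1 ?_
      push_cast
      linarith) (fun x hx0 hxs k ↦ by
      have hδ : Y ^ (-w) ≤ Y :=
        (Real.rpow_le_one_of_one_le_of_nonpos hY1.le (by linarith)).trans hY1.le
      have h1 := abs_windows_mulVec_le (r := r) (q := q) hδ hx0 hxs k
      refine lt_of_le_of_lt ?_ hY
      calc Y ^ θ * |((windows ξ m r q).map (Int.cast : ℤ → ℝ)).mulVec x k|
          ≤ Y ^ θ * (Ξ * (q * Y ^ (-w)) +
            (m + 1) * ((1 + m * max 1 |ξ| ^ m) * Y * err (m + r) ξ q)) := by gcongr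
        _ ≤ Y ^ θ * (Ξ * (Y ^ κ * Y ^ (-w)) +
            (m + 1) * ((1 + m * max 1 |ξ| ^ m) * Y * (2 ^ lam * Y ^ (-(κ * lam))))) := by gcongr
        _ = Ξ * (Y ^ θ * Y ^ κ * Y ^ (-w)) +
            D * 2 ^ lam * (Y ^ θ * Y ^ (1 : ℝ) * Y ^ (-(κ * lam))) := by
          rw [Real.rpow_one, hD]; ring
        _ = (Ξ + D * 2 ^ lam) * Y ^ η := by
          rw [← Real.rpow_add hY0, ← Real.rpow_add hY0, ← Real.rpow_add hY0, ← Real.rpow_add hY0,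
            show θ + κ + -w = η by rw [hη]; linarith,
            show θ + 1 + -(κ * lam) = η by rw [hη]; linarith]
          ring)
  exact linFormSolvable_of_coeffs hw0 hY1.le hp h0 hps

/-! ### The function `S`. -/

theorem R_sqrt_identities {t : ℝ} (ht : 0 < t) :
    1 - 2 * R t = √(2 * t - t ^ 2) / t ∧ 1 - R t = (t + √(2 * t - t ^ 2)) / (2 * t) ∧
      1 - t * R t = (2 - t + √(2 * t - t ^ 2)) / 2 := by
  refine ⟨?_, ?_, ?_⟩ <;> · rw [R]; field_simp; ring

/-- The denominator of `S` factors as `(1 - R t) * (1 - t * R t)`, and a factor `√(2t - t²)`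
cancels. The closed form covers `t = 2` and makes monotonicity and inversion immediate. -/
theorem S_eq {t : ℝ} (ht : t ∈ Set.Icc (1 : ℝ) 2) : S t = 2 / (1 + √(2 * t - t ^ 2)) := by
  obtain ⟨h1, h2⟩ := ht
  rcases h2.eq_or_lt with rfl | h2
  · norm_num [S]
  have hu : 0 < √(2 * t - t ^ 2) := Real.sqrt_pos.2 (by nlinarith)
  have hu2 : √(2 * t - t ^ 2) ^ 2 = 2 * t - t ^ 2 := Real.sq_sqrt (by nlinarith)
  obtain ⟨e1, e2, e3⟩ := R_sqrt_identities (by linarith : 0 < t)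
  set u := √(2 * t - t ^ 2)
  have hden : 1 - (t + 1) * R t + t * R t ^ 2 = u * (1 + u) / (2 * t) := by
    calc 1 - (t + 1) * R t + t * R t ^ 2 = (1 - R t) * (1 - t * R t) := by ring
      _ = _ := by
        rw [e2, e3]
        field_simp
        linear_combination -hu2
  rw [S, if_neg h2.ne, hden, e1]
  field_simp

theorem S_one : S 1 = 1 := by
  rw [S_eq ⟨le_rfl, by norm_num⟩]
  norm_num

theorem strictMonoOn_S : StrictMonoOn S (Set.Icc 1 2) := by
  intro a ha b hb hab
  rw [S_eq ha, S_eq hb]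
  have h0 : 0 ≤ √(2 * b - b ^ 2) := Real.sqrt_nonneg _
  have h1 : √(2 * b - b ^ 2) < √(2 * a - a ^ 2) :=
    Real.sqrt_lt_sqrt (by nlinarith [hb.1, hb.2]) (by nlinarith [ha.1, hb.1])
  exact div_lt_div_of_pos_left two_pos (by linarith) (by linarith)

theorem bijOn_S : Set.BijOn S (Set.Icc 1 2) (Set.Icc 1 2) := by
  refine ⟨fun t ht ↦ ?_, strictMonoOn_S.injOn, fun s hs ↦ ?_⟩
  · rw [S_eq ht]
    have h0 : 0 ≤ √(2 * t - t ^ 2) := Real.sqrt_nonneg _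
    have h1 : √(2 * t - t ^ 2) ≤ 1 := Real.sqrt_le_one.2 (by nlinarith [sq_nonneg (t - 1)])
    exact ⟨by rw [le_div_iff₀ (by linarith)]; linarith,
      by rw [div_le_iff₀ (by linarith)]; linarith⟩
  · obtain ⟨hs1, hs2⟩ := hs
    have hs0 : 0 < s := by linarith
    set v : ℝ := 2 / s - 1 with hv
    have hv0 : 0 ≤ v := by rw [hv, sub_nonneg, le_div_iff₀ hs0]; linarith
    have hv1 : v ≤ 1 := by rw [hv, sub_le_iff_le_add, div_le_iff₀ hs0]; linarith
    have hvs : 0 ≤ 1 - v ^ 2 := by nlinarith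
    have hr0 : 0 ≤ √(1 - v ^ 2) := Real.sqrt_nonneg _
    have hr1 : √(1 - v ^ 2) ≤ 1 := Real.sqrt_le_one.2 (by nlinarith)
    have ht : 1 + √(1 - v ^ 2) ∈ Set.Icc (1 : ℝ) 2 := ⟨by linarith, by linarith⟩
    refine ⟨1 + √(1 - v ^ 2), ht, ?_⟩
    rw [S_eq ht]
    have h1 : 2 * (1 + √(1 - v ^ 2)) - (1 + √(1 - v ^ 2)) ^ 2 = v ^ 2 := by
      linear_combination -(Real.sq_sqrt hvs)
    rw [h1, Real.sqrt_sq hv0, hv]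
    field_simp
    ring

/-! ### Asymptotic transference and passage to the limits. -/

/-- If the dimensions `m ≤ n` satisfy `m ≈ α n`, then the transference applies to the exponents
`t / n` and `s m`. -/
theorem eventually_transference {ξ t α s : ℝ} (hξ : Transcendental ℚ ξ) (htα : 1 < t * α)
    (hs0 : 0 ≤ s) (hs : s * α * (1 - t * (1 - α)) < 2 * α - 1) :
    ∃ n₀ : ℕ, ∀ n ≥ n₀, ∀ m ≤ n, |(m : ℝ) - α * n| ≤ 1 →
      (∀ᶠ X : ℝ in atTop, SimulSolvable n ξ (t / n) X) →
        ∀ᶠ X : ℝ in atTop, LinFormSolvable m ξ (s * m) X := by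
  -- At `(m / n, 1 / n)` this is the slack in the transference condition divided by `n`. It is
  -- positive at `(α, 0)`, so continuity covers all large `n`.
  let F : ℝ × ℝ → ℝ := fun x ↦
    2 * x.1 - 1 + (t * x.1 - 1) * x.2 - s * x.1 * (1 - t * (1 - x.1))
  have hF : Continuous F := by fun_prop
  have hev : ∀ᶠ x : ℝ × ℝ in nhds (α, 0), 0 < F x ∧ 1 < t * x.1 :=
    (hF.continuousAt.eventually_const_lt (by simp only [F]; linarith)).and
      ((by fun_prop : Continuous fun x : ℝ × ℝ ↦ t * x.1).continuousAt.eventually_const_lt htα)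
  obtain ⟨δ, hδ, hball⟩ := Metric.eventually_nhds_iff.1 hev
  obtain ⟨n₀, hn₀⟩ := exists_nat_gt (1 / δ)
  refine ⟨n₀, fun n hn m hmn hm hsim ↦ ?_⟩
  have hnδ : 1 / δ < n := hn₀.trans_le (by exact_mod_cast hn)
  have hn0 : (0 : ℝ) < n := lt_trans (by positivity) hnδ
  have hinv : 1 / (n : ℝ) < δ := by
    rw [div_lt_iff₀ hδ] at hnδ
    rw [div_lt_iff₀ hn0]
    linarith
  have hμ : |(m : ℝ) / n - α| < δ := by
    refine lt_of_le_of_lt ?_ hinv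
    rw [show (m : ℝ) / n - α = (m - α * n) / n by field_simp, abs_div, abs_of_pos hn0]
    gcongr
  obtain ⟨h1, h2⟩ := hball (y := ((m : ℝ) / n, 1 / (n : ℝ))) (by
    rw [Prod.dist_eq, max_lt_iff]
    refine ⟨by simpa [Real.dist_eq] using hμ, ?_⟩
    simpa [Real.dist_eq, abs_of_pos hn0] using hinv)
  obtain ⟨r, rfl⟩ := Nat.exists_eq_add_of_le hmn
  refine eventually_linFormSolvable_of_simulSolvable hξ (lam := t / (m + r : ℕ)) ?_ (by positivity)
    ?_ hsim
  · calc 1 < t * (m / (m + r : ℕ)) := h2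
      _ = t / (m + r : ℕ) * m := by ring
  · have h3 := mul_pos hn0 h1
    have h4 : ((m + r : ℕ) : ℝ) * F ((m : ℝ) / (m + r : ℕ), 1 / ((m + r : ℕ) : ℝ)) =
        m - r + t / (m + r : ℕ) * m - 1 - s * m * (1 - t / (m + r : ℕ) * r) := by
      simp only [F]
      push_cast at hn0 ⊢
      field_simp
      ring
    linarith

/-- The admissible ratio `α = 1 - R t` for a value `s < S t`. -/
theorem exists_ratio {s t : ℝ} (hs : 1 ≤ s) (ht : t ∈ Set.Icc (1 : ℝ) 2) (hst : s < S t) :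
    ∃ t' α : ℝ, t' < t ∧ 0 < α ∧ α < 1 ∧ 1 < t' * α ∧
      s * α * (1 - t' * (1 - α)) < 2 * α - 1 := by
  -- Writing `s' = S t'` gives `1 < t' < t ≤ 2`, away from both endpoints. At `α = 1 - R t'` the
  -- required inequality is an equality for `S t'`, hence strict for `s`.
  obtain ⟨s', h1, h2⟩ := exists_between hst
  obtain ⟨t', ht', rfl⟩ := bijOn_S.surjOn ⟨by linarith, h2.le.trans (bijOn_S.mapsTo ht).2⟩
  have htt : t' < t := (strictMonoOn_S.lt_iff_lt ht' ht).1 h2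
  have h1t : 1 < t' := by
    refine lt_of_le_of_ne ht'.1 ?_
    rintro rfl
    rw [S_one] at h1
    linarith
  have h2t : t' < 2 := htt.trans_le ht.2
  have h0t : 0 < t' := by linarith
  obtain ⟨e1, e2, e3⟩ := R_sqrt_identities h0t
  have hS := S_eq ht'
  set u := √(2 * t' - t' ^ 2) with hu
  have hu2 : u ^ 2 = 2 * t' - t' ^ 2 := Real.sq_sqrt (by nlinarith)
  have hu0 : 0 < u := Real.sqrt_pos.2 (by nlinarith)
  have hut : 2 - t' < u := Real.lt_sqrt_of_sq_lt (by nlinarith)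
  have hut' : u < t' := by nlinarith
  have hα0 : 0 < 1 - R t' := by rw [e2]; positivity
  have hβ0 : 0 < 1 - t' * R t' := by rw [e3]; linarith
  refine ⟨t', 1 - R t', htt, hα0, ?_, ?_, ?_⟩
  · rw [e2, div_lt_one (by linarith)]; linarith
  · rw [e2, show t' * ((t' + u) / (2 * t')) = (t' + u) / 2 by field_simp]; linarith
  · rw [sub_sub_cancel]
    have h3 : S t' * (1 - R t') * (1 - t' * R t') = 2 * (1 - R t') - 1 := by
      rw [show 2 * (1 - R t') - 1 = 1 - 2 * R t' by ring, e1, e2, e3, hS]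
      field_simp
      linear_combination -hu2
    rw [← h3, mul_assoc, mul_assoc]
    exact mul_lt_mul_of_pos_right h1 (mul_pos hα0 hβ0)

theorem le_hatW_div {m : ℕ} (hm : 0 < m) {ξ s : ℝ}
    (h : ∀ᶠ X : ℝ in atTop, LinFormSolvable m ξ (s * m) X) :
    (s : EReal) ≤ hatW m ξ / (m : EReal) := by
  rw [EReal.le_div_iff_mul_le (by exact_mod_cast hm) (EReal.natCast_ne_top m)]
  refine le_trans (le_of_eq ?_) (le_sSup (Set.mem_image_of_mem _ h))
  rw [EReal.coe_mul]
  rfl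

theorem le_hatW_div_of_lt_one {m : ℕ} (hm : 0 < m) (ξ : ℝ) {s : ℝ} (hs : s < 1) :
    (s : EReal) ≤ hatW m ξ / (m : EReal) := by
  have hm' : (0 : ℝ) < m := by exact_mod_cast hm
  refine le_trans (EReal.coe_le_coe_iff.2 (le_max_left s 0)) (le_hatW_div hm ?_)
  have h1 : max s 0 < 1 := max_lt hs one_pos
  exact eventually_linFormSolvable_of_lt ξ (by positivity) (by nlinarith)

theorem eventually_simulSolvable_of_lt_mul_hatLambda {n : ℕ} (hn : 0 < n) {ξ t : ℝ}
    (h : (t : EReal) < (n : EReal) * hatLambda n ξ) :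
    ∀ᶠ X : ℝ in atTop, SimulSolvable n ξ (t / n) X := by
  have hn' : (n : ℝ) ≠ 0 := by exact_mod_cast hn.ne'
  by_contra hcon
  refine absurd h (not_lt.2 ?_)
  have h1 : hatLambda n ξ ≤ ((t / n : ℝ) : EReal) := by
    refine sSup_le ?_
    rintro _ ⟨lam, hlam, rfl⟩
    rw [EReal.coe_le_coe_iff]
    by_contra! hlt
    apply hcon
    filter_upwards [hlam, eventually_ge_atTop 1] with X hX hX1
    exact hX.mono hX1 hlt.le
  refine (mul_le_mul_of_nonneg_left h1 (by positivity)).trans (le_of_eq ?_)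
  rw [← EReal.coe_natCast, ← EReal.coe_mul]
  congr 1
  field_simp

theorem one_le_mul_hatLambda {n : ℕ} (hn : 0 < n) (ξ : ℝ) :
    1 ≤ (n : EReal) * hatLambda n ξ := by
  have hn' : (0 : ℝ) < n := by exact_mod_cast hn
  have h1 : ((1 / n : ℝ) : EReal) ≤ hatLambda n ξ := by
    refine le_of_forall_lt fun c hc ↦ ?_
    obtain ⟨b, hcb, hb⟩ := EReal.lt_iff_exists_real_btwn.1 hc
    rw [EReal.coe_lt_coe_iff] at hb
    refine hcb.trans_le (le_trans (EReal.coe_le_coe_iff.2 (le_max_left b 0)) ?_)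
    refine le_sSup (Set.mem_image_of_mem _ ?_)
    exact eventually_simulSolvable_of_lt ξ (le_max_right _ _)
      ((lt_div_iff₀ hn').1 (max_lt hb (by positivity)))
  refine le_trans (le_of_eq ?_) (mul_le_mul_of_nonneg_left h1 (by positivity))
  rw [← EReal.coe_natCast, ← EReal.coe_mul, mul_one_div_cancel hn'.ne']
  rfl

/-- The Davenport-Schmidt bound with `m = n / 2` rounded down, so that `2 * m ≥ n - 1`. -/
theorem mul_hatLambda_le {n : ℕ} (hn : 2 ≤ n) {ξ : ℝ} (hξ : Transcendental ℚ ξ) :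
    (n : EReal) * hatLambda n ξ ≤ ((2 * n / (n - 1) : ℝ) : EReal) := by
  have hn' : (2 : ℝ) ≤ n := by exact_mod_cast hn
  have h1 : hatLambda n ξ ≤ ((2 / (n - 1) : ℝ) : EReal) := by
    refine sSup_le ?_
    rintro _ ⟨lam, hlam, rfl⟩
    rw [EReal.coe_le_coe_iff, le_div_iff₀ (by linarith)]
    have h2 : n / 2 + (n - n / 2) = n := by omega
    have hlam' : ∀ᶠ X : ℝ in atTop, SimulSolvable (n / 2 + (n - n / 2)) ξ lam X := by
      rwa [h2]
    have h3 := lam_mul_le_one hξ (by omega) hlam'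
    have h4 : (n : ℝ) ≤ 2 * (n / 2 : ℕ) + 1 := by exact_mod_cast (by omega : n ≤ 2 * (n / 2) + 1)
    rcases le_or_gt lam 0 with h5 | h5 <;> nlinarith
  refine (mul_le_mul_of_nonneg_left h1 (by positivity)).trans (le_of_eq ?_)
  rw [← EReal.coe_natCast, ← EReal.coe_mul]
  congr 1
  ring

theorem one_le_lowerHatLambda (ξ : ℝ) : 1 ≤ lowerHatLambda ξ :=
  le_liminf_of_le (by isBoundedDefault)
    ((eventually_gt_atTop 0).mono fun _ hn ↦ one_le_mul_hatLambda hn ξ)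

theorem lowerHatLambda_le_upperHatLambda (ξ : ℝ) : lowerHatLambda ξ ≤ upperHatLambda ξ :=
  liminf_le_limsup

theorem upperHatLambda_le_two {ξ : ℝ} (hξ : Transcendental ℚ ξ) :
    upperHatLambda ξ ≤ ((2 : ℝ) : EReal) := by
  refine le_of_forall_gt fun c hc ↦ ?_
  obtain ⟨b, hb, hbc⟩ := EReal.lt_iff_exists_real_btwn.1 hc
  rw [EReal.coe_lt_coe_iff] at hb
  refine lt_of_le_of_lt (limsup_le_of_le (by isBoundedDefault) ?_) hbc
  obtain ⟨k, hk⟩ := exists_nat_gt (b / (b - 2))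
  filter_upwards [eventually_ge_atTop 2, eventually_ge_atTop k] with n hn hnk
  have hn' : (2 : ℝ) ≤ n := by exact_mod_cast hn
  have hnk' : b / (b - 2) < n := hk.trans_le (by exact_mod_cast hnk)
  rw [div_lt_iff₀ (by linarith)] at hnk'
  refine (mul_hatLambda_le hn hξ).trans ?_
  rw [EReal.coe_le_coe_iff, div_le_iff₀ (by linarith)]
  linarith

theorem exists_real_of_mem_Icc {x : EReal} (h1 : 1 ≤ x) (h2 : x ≤ ((2 : ℝ) : EReal)) :
    ∃ t : ℝ, t ∈ Set.Icc (1 : ℝ) 2 ∧ x = t := by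
  have htop : x ≠ ⊤ := (h2.trans_lt (EReal.coe_lt_top 2)).ne
  have hbot : x ≠ ⊥ := ((EReal.bot_lt_coe 1).trans_le h1).ne'
  lift x to ℝ using ⟨htop, hbot⟩
  exact ⟨x, ⟨EReal.coe_le_coe_iff.1 h1, EReal.coe_le_coe_iff.1 h2⟩, rfl⟩

/-- Infinitely many good `n` give infinitely many good `m = ⌈α * n⌉₊`. -/
theorem S_le_upperHatW {ξ t : ℝ} (hξ : Transcendental ℚ ξ) (ht : t ∈ Set.Icc (1 : ℝ) 2)
    (h : upperHatLambda ξ = t) : (S t : EReal) ≤ upperHatW ξ := by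
  refine le_of_forall_lt fun c hc ↦ ?_
  obtain ⟨s, hcs, hs⟩ := EReal.lt_iff_exists_real_btwn.1 hc
  rw [EReal.coe_lt_coe_iff] at hs
  refine hcs.trans_le (le_limsup_of_frequently_le ?_ (by isBoundedDefault))
  rcases lt_or_ge s 1 with hs1 | hs1
  · exact ((eventually_gt_atTop 0).mono fun m hm ↦ le_hatW_div_of_lt_one hm ξ hs1).frequently
  obtain ⟨t', α, htt, hα0, hα1, htα, hineq⟩ := exists_ratio hs1 ht hs
  obtain ⟨n₀, hn₀⟩ := eventually_transference hξ htα (by linarith) hineq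
  have hfreq : ∃ᶠ n : ℕ in atTop, (t' : EReal) < (n : EReal) * hatLambda n ξ :=
    frequently_lt_of_lt_limsup (by isBoundedDefault)
      (by rw [← upperHatLambda, h]; exact_mod_cast htt)
  refine frequently_atTop.2 fun a ↦ ?_
  obtain ⟨k, hk⟩ := exists_nat_gt ((a + 1) / α)
  obtain ⟨n, hn, hnt⟩ := frequently_atTop.1 hfreq (max (max n₀ k) 1)
  have hnn₀ : n₀ ≤ n := by omega
  have hn1 : 1 ≤ n := by omega
  have hn1' : (1 : ℝ) ≤ n := by exact_mod_cast hn1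
  have hak : (a + 1 : ℝ) < α * n := by
    have : (a + 1) / α < (n : ℝ) := hk.trans_le (by exact_mod_cast (by omega : k ≤ n))
    rw [div_lt_iff₀ hα0] at this
    linarith
  have hc1 := Nat.le_ceil (α * n)
  have hc2 := Nat.ceil_lt_add_one (by positivity : 0 ≤ α * n)
  have ham : a + 1 ≤ ⌈α * n⌉₊ := by
    have : ((a + 1 : ℕ) : ℝ) ≤ ⌈α * n⌉₊ := by push_cast; linarith
    exact_mod_cast this
  refine ⟨⌈α * n⌉₊, by omega, le_hatW_div (by omega) (hn₀ n hnn₀ _ ?_ ?_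
    (eventually_simulSolvable_of_lt_mul_hatLambda hn1 hnt))⟩
  · exact Nat.ceil_le.2 (mul_le_of_le_one_left (by positivity) hα1.le)
  · rw [abs_le]
    constructor <;> linarith

/-- Here every large `m` must be reached, so `m` is given and `n = ⌊m / α⌋₊` is chosen; all large
`n` are good. -/
theorem S_le_lowerHatW {ξ t : ℝ} (hξ : Transcendental ℚ ξ) (ht : t ∈ Set.Icc (1 : ℝ) 2)
    (h : lowerHatLambda ξ = t) : (S t : EReal) ≤ lowerHatW ξ := by
  refine le_of_forall_lt fun c hc ↦ ?_
  obtain ⟨s, hcs, hs⟩ := EReal.lt_iff_exists_real_btwn.1 hc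
  rw [EReal.coe_lt_coe_iff] at hs
  refine hcs.trans_le (le_liminf_of_le (by isBoundedDefault) ?_)
  rcases lt_or_ge s 1 with hs1 | hs1
  · exact (eventually_gt_atTop 0).mono fun m hm ↦ le_hatW_div_of_lt_one hm ξ hs1
  obtain ⟨t', α, htt, hα0, hα1, htα, hineq⟩ := exists_ratio hs1 ht hs
  obtain ⟨n₀, hn₀⟩ := eventually_transference hξ htα (by linarith) hineq
  have hev : ∀ᶠ n : ℕ in atTop, (t' : EReal) < (n : EReal) * hatLambda n ξ :=
    eventually_lt_of_lt_liminf (by rw [← lowerHatLambda, h]; exact_mod_cast htt)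
  obtain ⟨k, hk⟩ := eventually_atTop.1 hev
  obtain ⟨l, hl⟩ := exists_nat_gt (α / (1 - α))
  filter_upwards [eventually_ge_atTop (max (max n₀ k) (max l 1))] with m hm
  have hlm : α / (1 - α) < m := hl.trans_le (by exact_mod_cast (by omega : l ≤ m))
  rw [div_lt_iff₀ (by linarith)] at hlm
  have hf1 := Nat.floor_le (by positivity : 0 ≤ (m : ℝ) / α)
  have hf2 := Nat.lt_floor_add_one ((m : ℝ) / α)
  rw [le_div_iff₀ hα0] at hf1
  rw [div_lt_iff₀ hα0] at hf2
  have hmn : m ≤ ⌊(m : ℝ) / α⌋₊ := by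
    rw [Nat.le_floor_iff (by positivity), le_div_iff₀ hα0]
    exact mul_le_of_le_one_right (by positivity) hα1.le
  refine le_hatW_div (by omega) (hn₀ ⌊(m : ℝ) / α⌋₊ (by omega) m hmn ?_
    (eventually_simulSolvable_of_lt_mul_hatLambda (by omega) (hk _ (by omega))))
  rw [abs_le]
  constructor <;> linarith

end DiophExp

theorem corollary2p3 :
    (∀ ξ : ℝ, Transcendental ℚ ξ →
      (∃ t : ℝ, t ∈ Set.Icc (1 : ℝ) 2 ∧ DiophExp.upperHatLambda ξ = (t : EReal) ∧
        (DiophExp.S t : EReal) ≤ DiophExp.upperHatW ξ) ∧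
      (∃ t : ℝ, t ∈ Set.Icc (1 : ℝ) 2 ∧ DiophExp.lowerHatLambda ξ = (t : EReal) ∧
        (DiophExp.S t : EReal) ≤ DiophExp.lowerHatW ξ)) ∧
    StrictMonoOn DiophExp.S (Set.Icc 1 2) ∧
    Set.BijOn DiophExp.S (Set.Icc 1 2) (Set.Icc 1 2) := by
  refine ⟨fun ξ hξ ↦ ?_, DiophExp.strictMonoOn_S, DiophExp.bijOn_S⟩
  have h1 := DiophExp.one_le_lowerHatLambda ξ
  have h2 := DiophExp.lowerHatLambda_le_upperHatLambda ξ
  have h3 := DiophExp.upperHatLambda_le_two hξ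
  obtain ⟨t, ht, hte⟩ := DiophExp.exists_real_of_mem_Icc (h1.trans h2) h3
  obtain ⟨t', ht', hte'⟩ := DiophExp.exists_real_of_mem_Icc h1 (h2.trans h3)
  exact ⟨⟨t, ht, hte, DiophExp.S_le_upperHatW hξ ht hte⟩,
    ⟨t', ht', hte', DiophExp.S_le_lowerHatW hξ ht' hte'⟩⟩
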